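/- In a graph $G$ with a given edge colouring (adjacent edges may receive the same colour), a rainbow path is a path all of whose edges have distinct colours, and the colouring is a rainbow colouring if every pair of vertices is joined by at least one rainbow path. The rainbow connection number $\mathrm{rc}(G)$ is the minimum number of colours in a rainbow colouring of $G$ ($\infty$ if $G$ is disconnected), and $\mathrm{diam}(G)$ is the diameter of $G$ ($\infty$ if $G$ is disconnected). For $p\in[0,1]$, let $\mathcal G(n,p)$ denote the random graph on $n$ vertices in which each of the $\binom n2$ potential edges is present independently with probability $p$. **Theorem.** Let $\omega(n)$ be a real sequence (of any sign) with $\omega(n)=o(\log n)$ as $n\to\infty$, and let $p=p(n)\in[0,1]$ satisfy $p(n)=\sqrt{\frac{2\log n+\omega(n)}{n}}$ for all sufficiently large $n$. Let $G\sim\mathcal G(n,p)$. Then with high probability $\mathrm{rc}(G)=\mathrm{diam}(G)\in\{2,3\}$, that is, $$\lim_{n\to\infty}\mathbb P\bigl(\mathrm{rc}(G)=\mathrm{diam}(G)\in\{2,3\}\bigr)=1.$$ -/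

import Mathlib

open Filter MeasureTheory Asymptotics
open scoped Topology

namespace SimpleGraph

/-- A walk is a rainbow path with respect to an edge colouring `C` if it is a path and
all its edges have distinct colours (the edges of a path are themselves distinct). -/
def Walk.IsRainbowPath {V K : Type*} {G : SimpleGraph V} (C : G.EdgeLabeling K) {u v : V}
    (w : G.Walk u v) : Prop :=
  w.IsPath ∧ Set.InjOn C {e : G.edgeSet | (e : Sym2 V) ∈ w.edges}

/-- An edge colouring (adjacent edges may share a colour) is a rainbow colouring if every pair of
vertices is joined by at least one rainbow path. -/
def EdgeLabeling.IsRainbow {V K : Type*} {G : SimpleGraph V} (C : G.EdgeLabeling K) : Prop :=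
  ∀ u v : V, ∃ w : G.Walk u v, w.IsRainbowPath C

/-- The rainbow connection number: the minimum number `k` of colours for which there is a rainbow
colouring with `k` colours, and `⊤` if there is no such `k` (as for disconnected graphs). -/
noncomputable def rainbowConnectionNumber {V : Type*} (G : SimpleGraph V) : ℕ∞ :=
  ⨅ (k : ℕ) (_ : ∃ C : G.EdgeLabeling (Fin k), C.IsRainbow), (k : ℕ∞)

end SimpleGraph

/-!
The rainbow connection number is at least the diameter, and the diameter is at least two because
some pair is nonadjacent. So it suffices that, with high probability, three colours always suffice
and two colours suffice whenever the diameter is at most two. The probability that the diameter is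
two need not be known.

*Three colours.* Colour the pair `{x, y}` of integers by `x + y` modulo three. For any `u ≠ v` there
are two residues `a ≠ b` such that every path `u, x, y, v` with `x ≡ a` and `y ≡ b` is rainbow
(`rainbowConnectionNumber_le_three`). There are so many candidates for `x` and `y` that with high
probability such a path exists for all `u`, `v` at once (`measureReal_no_residue_path_le`).

*Two colours.* Call a nonadjacent pair thin if it has fewer than `K` common neighbours, `K` a
constant. A given pair is thin with probability `n ^ (-2 + o(1))`, so with high probability thin
pairs are scattered: no two meet, are joined by an edge, or have a vertex adjacent to all four of
their members. If the diameter is at most two, each thin pair has a common neighbour, and the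
resulting paths of length two are edge-disjoint and put at most three edges at each vertex. They
are coloured first, with two different colours on each path.

The other nonadjacent pairs keep all but at most six of their common neighbours. A pair with `f`
remaining common neighbours has `2 ^ f` bad colourings on `2 f` edges, and these pairs are handled
together by a counting argument that takes the place of the local lemma: if the bad colourings
through each edge, with a colouring pattern on `d` edges weighted `β ^ (1 - d)`, have total weight
at most `2 - β`, then colouring one more edge multiplies the number of partial colourings without a
bad pair by at least `β` (`mul_card_validSubsets_le`, `exists_forall_inter_notMem`). The
weight at an edge is controlled by its load `edgeLoad`. Once the neighbourhood of `u` is exposed,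
the load of `{u, w}` is a sum of independent terms in `[0, 1]` whose mean is a negative power of
`n`, and an exponential moment bounds it by a constant simultaneously for all edges
(`measureReal_edgeLoad_ge_le`).
-/

namespace SimpleGraph

/-! ### Independence of disjoint blocks of edges -/

section Independence

open ProbabilityTheory unitInterval

variable {V : Type*}

/-- `f G` is determined by which of the pairs in `S` are edges of `G`. Loops are allowed in `S` and
carry no information. -/
def DependsOnEdges {β : Type*} (f : SimpleGraph V → β) (S : Set (Sym2 V)) : Prop :=
  ∀ G H : SimpleGraph V, (∀ e ∈ S, e ∈ G.edgeSet ↔ e ∈ H.edgeSet) → f G = f H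

lemma DependsOnEdges.prod {ι : Type*} {f : ι → SimpleGraph V → ℝ} {S : ι → Set (Sym2 V)}
    {s : Finset ι} (hf : ∀ i ∈ s, DependsOnEdges (f i) (S i)) :
    DependsOnEdges (fun G ↦ ∏ i ∈ s, f i G) (⋃ i ∈ s, S i) :=
  fun G H hGH ↦ Finset.prod_congr rfl fun i hi ↦
    hf i hi G H fun e he ↦ hGH e (Set.mem_biUnion hi he)

variable [Fintype V] (p : I)

instance : DiscreteMeasurableSpace (SimpleGraph V) where
  forall_measurableSet S := by
    have : MeasurableSet (edgeSet ⁻¹' (edgeSet '' S)) :=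
      measurable_edgeSet (V := V) (Set.toFinite _).measurableSet
    rwa [Set.preimage_image_eq _ edgeSet_injective] at this

lemma map_mem_edgeSet_binomialRandom :
    (binomialRandom V p).map (fun G e ↦ e ∈ G.edgeSet) = Measure.infinitePi
      (fun e : Sym2 V ↦ toNNReal p • Measure.dirac (e ∈ (Sym2.diagSetᶜ : Set (Sym2 V))) +
        toNNReal (σ p) • Measure.dirac False) := by
  have h1 : (binomialRandom V p).map edgeSet = setBernoulli Sym2.diagSetᶜ p := by
    rw [binomialRandom_eq_map, Measure.map_map (by fun_prop) (by fun_prop)]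
    conv_rhs => rw [← Measure.map_id (μ := setBernoulli Sym2.diagSetᶜ p)]
    refine Measure.map_congr ?_
    filter_upwards [setBernoulli_ae_subset] with s hs
    simpa [Set.disjoint_compl_right_iff_subset, Set.disjoint_left, Set.subset_def] using hs
  have h2 : (fun (G : SimpleGraph V) (e : Sym2 V) ↦ e ∈ G.edgeSet) =
      MeasurableEquiv.setOfPred.symm ∘ edgeSet := rfl
  rw [h2, ← Measure.map_map (by fun_prop) (by fun_prop), h1, setBernoulli_eq_map]
  exact MeasurableEquiv.map_symm_map (μ := Measure.infinitePi _) MeasurableEquiv.setOfPred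

lemma iIndepFun_mem_edgeSet :
    iIndepFun (fun (e : Sym2 V) (G : SimpleGraph V) ↦ e ∈ G.edgeSet) (binomialRandom V p) := by
  rw [iIndepFun_iff_map_fun_eq_infinitePi_map (fun _ ↦ .of_discrete)]
  rw [map_mem_edgeSet_binomialRandom]
  congr with e : 1
  rw [← Measure.infinitePi_map_eval (fun e : Sym2 V ↦
        toNNReal p • Measure.dirac (e ∈ (Sym2.diagSetᶜ : Set (Sym2 V))) +
        toNNReal (σ p) • Measure.dirac False) e, ← map_mem_edgeSet_binomialRandom, Measure.map_map]
  · rfl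
  · fun_prop
  · exact .of_discrete

/-- Functions determined by disjoint sets of pairs are independent. -/
lemma integral_mul_of_dependsOnEdges {f g : SimpleGraph V → ℝ} {S T : Set (Sym2 V)}
    (hf : DependsOnEdges f S) (hg : DependsOnEdges g T) (hST : Disjoint S T) :
    ∫ G, f G * g G ∂binomialRandom V p =
      (∫ G, f G ∂binomialRandom V p) * ∫ G, g G ∂binomialRandom V p := by
  classical
  have key : ∀ {f : SimpleGraph V → ℝ} {S : Set (Sym2 V)}, DependsOnEdges f S →
      ∃ φ : (S.toFinset → Prop) → ℝ, f = φ ∘ fun G (e : S.toFinset) ↦ (e : Sym2 V) ∈ G.edgeSet := by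
    intro f S hf
    refine ⟨fun x ↦ f (fromEdgeSet {e | ∃ h : e ∈ S.toFinset, x ⟨e, h⟩}), funext fun G ↦ ?_⟩
    refine hf _ _ fun e he ↦ ?_
    have := G.not_isDiag_of_mem_edgeSet (e := e)
    simp_all
  obtain ⟨φ, rfl⟩ := key hf
  obtain ⟨ψ, rfl⟩ := key hg
  have h := (iIndepFun_mem_edgeSet p).indepFun_finset S.toFinset T.toFinset (by simpa)
    fun _ ↦ .of_discrete
  exact (h.comp (φ := φ) (ψ := ψ) .of_discrete .of_discrete).integral_fun_mul_eq_mul_integral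
    (Integrable.of_finite).aestronglyMeasurable (Integrable.of_finite).aestronglyMeasurable

lemma integral_prod_of_dependsOnEdges {ι : Type*} {f : ι → SimpleGraph V → ℝ}
    {S : ι → Set (Sym2 V)} {s : Finset ι} (hf : ∀ i ∈ s, DependsOnEdges (f i) (S i))
    (hS : (s : Set ι).PairwiseDisjoint S) :
    ∫ G, ∏ i ∈ s, f i G ∂binomialRandom V p = ∏ i ∈ s, ∫ G, f i G ∂binomialRandom V p := by
  classical
  induction s using Finset.induction_on with
  | empty => simp
  | insert a s ha ih =>
    simp only [Finset.prod_insert ha]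
    rw [integral_mul_of_dependsOnEdges p (hf a (by simp))
      (DependsOnEdges.prod (s := s) fun i hi ↦ hf i (by simp [hi])), ih]
    · exact fun i hi ↦ hf i (by simp [hi])
    · exact hS.subset (by simp)
    · simp only [Set.disjoint_iUnion_right]
      exact fun i hi ↦ hS (by simp) (by simp [hi]) (by grind)

lemma measureReal_adj {u v : V} (huv : u ≠ v) :
    (binomialRandom V p).real {G | G.Adj u v} = p := by
  have h := congrArg (Measure.map (fun x : Sym2 V → Prop ↦ x s(u, v)))
    (map_mem_edgeSet_binomialRandom (V := V) p)
  rw [Measure.infinitePi_map_eval, Measure.map_map (by fun_prop) .of_discrete] at h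
  have h' := congrArg (fun ν ↦ ν {True}) h
  simp only [Measure.map_apply .of_discrete (MeasurableSet.of_discrete (s := {True}))] at h'
  rw [measureReal_def]
  convert congrArg ENNReal.toReal h' using 1
  · congr 2
    ext G
    simp
  · simp [huv]

open Classical in
lemma integral_adj_ite {u v : V} (huv : u ≠ v) (a b : ℝ) :
    ∫ G : SimpleGraph V, (if G.Adj u v then a else b) ∂binomialRandom V p =
      p * a + (1 - p) * b := by
  have h : (fun G : SimpleGraph V ↦ if G.Adj u v then a else b) =
      fun G ↦ {G : SimpleGraph V | G.Adj u v}.indicator (fun _ ↦ a - b) G + b := by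
    ext G
    by_cases hG : G.Adj u v <;> simp [hG]
  rw [h, integral_add .of_finite .of_finite, integral_indicator .of_discrete]
  simp [measureReal_adj p huv]
  ring

end Independence

/-! ### Exposing a neighbourhood -/

section Estimates

open Classical ProbabilityTheory unitInterval

variable {V : Type*}

/-- The pairs `{v, a}` with `a ∈ A`. -/
def starPairs (v : V) (A : Finset V) : Set (Sym2 V) := {e | ∃ a ∈ A, e = s(v, a)}

lemma dependsOnEdges_starPairs {β : Type*} {f : SimpleGraph V → β} {v : V} {A : Finset V}
    (h : ∀ G H : SimpleGraph V, (∀ a ∈ A, G.Adj v a ↔ H.Adj v a) → f G = f H) :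
    DependsOnEdges f (starPairs v A) :=
  fun G H hGH ↦ h G H fun a ha ↦ by simpa using hGH s(v, a) ⟨a, ha, rfl⟩

lemma disjoint_starPairs {v w : V} {A B : Finset V} (hvw : v ≠ w) (h : v ∉ B ∨ w ∉ A) :
    Disjoint (starPairs v A) (starPairs w B) := by
  rw [Set.disjoint_left]
  rintro e ⟨a, ha, rfl⟩ ⟨b, hb, he⟩
  rw [Sym2.eq_iff] at he
  grind

lemma disjoint_starPairs_of_disjoint {v : V} {A B : Finset V} (hAB : Disjoint A B) :
    Disjoint (starPairs v A) (starPairs v B) := by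
  rw [Set.disjoint_left]
  rintro e ⟨a, ha, rfl⟩ ⟨b, hb, he⟩
  rw [Sym2.eq_iff] at he
  have := Finset.disjoint_left.1 hAB
  grind

variable [Fintype V] (p : I)

lemma measureReal_le_integral {E : Set (SimpleGraph V)} {f : SimpleGraph V → ℝ}
    (h0 : ∀ G, 0 ≤ f G) (h1 : ∀ G ∈ E, 1 ≤ f G) :
    (binomialRandom V p).real E ≤ ∫ G, f G ∂binomialRandom V p := by
  rw [← integral_indicator_one (.of_discrete)]
  refine integral_mono .of_finite .of_finite fun G ↦ ?_
  by_cases hG : G ∈ E <;> simp [hG, h0, h1]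

lemma integral_prod_adj_ite {v : V} {A : Finset V} (hv : v ∉ A) (s : ℝ) :
    ∫ G : SimpleGraph V, ∏ a ∈ A, (if G.Adj v a then s else 1) ∂binomialRandom V p =
      (1 - p * (1 - s)) ^ A.card := by
  rw [integral_prod_of_dependsOnEdges p (S := fun a ↦ starPairs v {a})
    (f := fun a (G : SimpleGraph V) ↦ if G.Adj v a then s else 1)]
  · rw [Finset.prod_congr rfl fun a ha ↦ integral_adj_ite p (by grind) s 1]
    simp only [Finset.prod_const]
    congr 1
    ring
  · exact fun a _ ↦ dependsOnEdges_starPairs fun G H h ↦ by simp [h a]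
  · exact fun a _ b _ hab ↦ disjoint_starPairs_of_disjoint (by simpa)

lemma pow_card_filter_eq_prod {α : Type*} (A : Finset α) (P : α → Prop) [DecidablePred P]
    (s : ℝ) :
    s ^ (A.filter P).card = ∏ a ∈ A, (if P a then s else 1) := by
  simp [Finset.prod_ite]

/-- Lower tail of a binomial degree, from the moment `E[2 ^ (-degree)]`. -/
lemma measureReal_card_filter_adj_le {v : V} {A : Finset V} (hv : v ∉ A) (α : ℝ) :
    (binomialRandom V p).real {G | ((A.filter (G.Adj v)).card : ℝ) ≤ α} ≤
      Real.exp (α * Real.log 2 - p * A.card / 2) := by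
  calc _ ≤ ∫ G, Real.exp (α * Real.log 2) * ∏ a ∈ A, (if G.Adj v a then (1 / 2 : ℝ) else 1)
        ∂binomialRandom V p := by
        refine measureReal_le_integral p
          (fun G ↦ mul_nonneg (Real.exp_nonneg _) (Finset.prod_nonneg fun a _ ↦ by positivity))
          fun G hG ↦ ?_
        rw [← pow_card_filter_eq_prod, one_div, inv_pow, ← Real.rpow_natCast,
          ← div_eq_mul_inv, one_le_div (by positivity), mul_comm, ← Real.rpow_def_of_pos (by simp)]
        exact Real.rpow_le_rpow_of_exponent_le (by norm_num) hG
    _ = Real.exp (α * Real.log 2) * (1 - p * (1 - 1 / 2)) ^ A.card := by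
        rw [integral_const_mul, integral_prod_adj_ite p hv]
    _ ≤ Real.exp (α * Real.log 2) * (Real.exp (-(p / 2))) ^ A.card := by
        have := p.2.1
        have := p.2.2
        gcongr
        · linarith
        · linarith [Real.add_one_le_exp (-(p / 2 : ℝ))]
    _ = _ := by
        rw [← Real.exp_nat_mul, ← Real.exp_add]
        congr 1
        ring

/-- Exposing the neighbourhood of `u` inside `X`: if, for each possible value `A` with at least `m`
elements, the event `E` has conditional probability at most `B`, as witnessed by a function `f A`
of the pairs outside the star of `u`, then so it has unconditionally. -/
lemma measureReal_le_of_expose {u : V} {X : Finset V} {m B : ℝ} (hB : 0 ≤ B)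
    {E : Set (SimpleGraph V)} (hE : ∀ G ∈ E, m ≤ ((X.filter (G.Adj u)).card : ℝ))
    (f : Finset V → SimpleGraph V → ℝ) (S : Finset V → Set (Sym2 V))
    (hf0 : ∀ A ⊆ X, ∀ G, 0 ≤ f A G)
    (hf1 : ∀ G ∈ E, 1 ≤ f (X.filter (G.Adj u)) G)
    (hdep : ∀ A ⊆ X, DependsOnEdges (f A) (S A))
    (hS : ∀ A ⊆ X, Disjoint (starPairs u X) (S A))
    (hfB : ∀ A ⊆ X, m ≤ A.card → ∫ G, f A G ∂binomialRandom V p ≤ B) :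
    (binomialRandom V p).real E ≤ B := by
  set F : Finset (Finset V) := X.powerset.filter fun A ↦ m ≤ A.card
  let g : Finset V → SimpleGraph V → ℝ := fun A G ↦ if X.filter (G.Adj u) = A then 1 else 0
  have hg0 : ∀ A G, 0 ≤ g A G := fun A G ↦ by simp only [g]; positivity
  have hgS : ∀ A, DependsOnEdges (g A) (starPairs u X) := fun A ↦
    dependsOnEdges_starPairs fun G H h ↦ by
      simp only [g]
      rw [Finset.filter_congr h]
  have hF : ∀ A ∈ F, A ⊆ X ∧ m ≤ A.card := fun A hA ↦ by simpa [F] using hA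
  calc _ ≤ ∫ G, ∑ A ∈ F, g A G * f A G ∂binomialRandom V p := by
        refine measureReal_le_integral p
          (fun G ↦ Finset.sum_nonneg fun A hA ↦ mul_nonneg (hg0 A G) (hf0 A (hF A hA).1 G))
          fun G hG ↦ ?_
        refine (hf1 G hG).trans ?_
        have := Finset.single_le_sum (f := fun A ↦ g A G * f A G)
          (fun A hA ↦ mul_nonneg (hg0 A G) (hf0 A (hF A hA).1 G))
          (show X.filter (G.Adj u) ∈ F by simpa [F] using hE G hG)
        simpa [g] using this
    _ = ∑ A ∈ F, (∫ G, g A G ∂binomialRandom V p) * ∫ G, f A G ∂binomialRandom V p := by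
        rw [integral_finsetSum _ fun _ _ ↦ .of_finite]
        exact Finset.sum_congr rfl fun A hA ↦
          integral_mul_of_dependsOnEdges p (hgS A) (hdep A (hF A hA).1) (hS A (hF A hA).1)
    _ ≤ ∑ A ∈ F, (∫ G, g A G ∂binomialRandom V p) * B := by
        refine Finset.sum_le_sum fun A hA ↦ ?_
        exact mul_le_mul_of_nonneg_left (hfB A (hF A hA).1 (hF A hA).2)
          (integral_nonneg fun G ↦ hg0 A G)
    _ = (∫ G, ∑ A ∈ F, g A G ∂binomialRandom V p) * B := by
        rw [integral_finsetSum (μ := binomialRandom V p) (f := g) F fun _ _ ↦ .of_finite,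
          Finset.sum_mul]
    _ ≤ (∫ G, 1 ∂binomialRandom V p) * B := by
        refine mul_le_mul_of_nonneg_right (integral_mono .of_finite .of_finite fun G ↦ ?_) hB
        simp only [g, Finset.sum_ite_eq]
        split_ifs <;> norm_num
    _ = B := by simp

/-- For disjoint `X` and `Y`, it is unlikely that `u` has many neighbours in `X` and yet no path
`u, x, y, v` has `x ∈ X` and `y ∈ Y`. -/
lemma measureReal_no_path_le {u v : V} {X Y : Finset V} (huX : u ∉ X) (huY : u ∉ Y)
    (hvX : v ∉ X) (hvY : v ∉ Y) (huv : u ≠ v) (hXY : Disjoint X Y) {m : ℕ} :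
    (binomialRandom V p).real {G | (m : ℝ) ≤ (X.filter (G.Adj u)).card ∧
      ∀ x ∈ X, ∀ y ∈ Y, G.Adj u x → G.Adj x y → ¬ G.Adj y v} ≤
      (1 - p * (1 - (1 - p : ℝ) ^ m)) ^ Y.card := by
  have hp0 := p.2.1
  have hp1 := p.2.2
  have hle : (1 - p : ℝ) ^ m ≤ 1 := pow_le_one₀ (by linarith) (by linarith)
  have hle0 : 0 ≤ (1 - p : ℝ) ^ m := pow_nonneg (by linarith) _
  -- for `y ∈ Y`, the failure of `y` to complete a path through `A`
  let h : Finset V → V → SimpleGraph V → ℝ := fun A y G ↦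
    1 - (if G.Adj y v then 1 else 0) * (1 - ∏ a ∈ A, if G.Adj y a then (0 : ℝ) else 1)
  have hprod : ∀ (A : Finset V) (y : V) (G : SimpleGraph V),
      0 ≤ (∏ a ∈ A, if G.Adj y a then (0 : ℝ) else 1) ∧
      (∏ a ∈ A, if G.Adj y a then (0 : ℝ) else 1) ≤ 1 := fun A y G ↦
    ⟨Finset.prod_nonneg fun a _ ↦ by positivity,
      Finset.prod_le_one (fun a _ ↦ by positivity) fun a _ ↦ by split_ifs <;> norm_num⟩
  refine measureReal_le_of_expose p (u := u) (X := X) (m := m) ?_ (fun G hG ↦ hG.1)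
    (fun A G ↦ ∏ y ∈ Y, h A y G) (fun A ↦ ⋃ y ∈ Y, starPairs y (insert v A)) ?_ ?_ ?_ ?_ ?_
  · exact pow_nonneg (by nlinarith) _
  · refine fun A _ G ↦ Finset.prod_nonneg fun y _ ↦ ?_
    have := hprod A y G
    simp only [h]
    split_ifs <;> linarith
  · rintro G ⟨-, hG⟩
    refine (Finset.prod_eq_one fun y hy ↦ ?_).ge
    simp only [h, sub_eq_self, mul_eq_zero, ite_eq_right_iff, one_ne_zero, imp_false]
    by_cases hyv : G.Adj y v
    · right
      rw [Finset.prod_eq_one, sub_self]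
      intro a ha
      simp only [Finset.mem_filter] at ha
      rw [if_neg fun hya ↦ hG a ha.1 y hy ha.2 hya.symm hyv]
    · exact .inl hyv
  · refine fun A _ ↦ DependsOnEdges.prod fun y _ ↦ dependsOnEdges_starPairs fun G H hGH ↦ ?_
    simp only [h, hGH v (by simp)]
    rw [Finset.prod_congr rfl fun a ha ↦ by rw [hGH a (by simp [ha])]]
  · intro A hA
    simp only [Set.disjoint_iUnion_right]
    intro y hy
    exact disjoint_starPairs (by grind) (.inl (by grind))
  · intro A hA hm
    have hm' : m ≤ A.card := by exact_mod_cast hm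
    rw [integral_prod_of_dependsOnEdges p (f := h A) (S := fun y ↦ starPairs y (insert v A))]
    · rw [← Finset.prod_const]
      refine Finset.prod_le_prod (fun y _ ↦ integral_nonneg fun G ↦ ?_) fun y hy ↦ ?_
      · have := hprod A y G
        simp only [h, Pi.zero_apply]
        split_ifs <;> linarith
      · have hyA : y ∉ A := fun hy' ↦ Finset.disjoint_left.1 hXY (hA hy') hy
        have hyv : y ≠ v := by grind
        simp only [h]
        rw [integral_sub .of_finite .of_finite, integral_mul_of_dependsOnEdges p
          (S := starPairs y {v}) (T := starPairs y A), integral_adj_ite p hyv,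
          integral_sub .of_finite .of_finite, integral_prod_adj_ite p hyA]
        · simp only [integral_const, probReal_univ, smul_eq_mul, mul_one, mul_zero, add_zero,
            sub_zero]
          have := pow_le_pow_of_le_one (show (0 : ℝ) ≤ 1 - p by linarith) (by linarith) hm'
          gcongr
        · exact dependsOnEdges_starPairs fun G H hGH ↦ by simp [hGH v]
        · refine dependsOnEdges_starPairs fun G H hGH ↦ ?_
          rw [Finset.prod_congr rfl fun a ha ↦ by rw [hGH a ha]]
        · exact disjoint_starPairs_of_disjoint (Finset.disjoint_singleton_left.2 fun h ↦ hvX (hA h))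
    · refine fun y _ ↦ dependsOnEdges_starPairs fun G H hGH ↦ ?_
      simp only [h, hGH v (by simp)]
      rw [Finset.prod_congr rfl fun a ha ↦ by rw [hGH a (by simp [ha])]]
    · intro y hy y' hy' hyy'
      refine disjoint_starPairs hyy' (.inl ?_)
      have := Finset.disjoint_left.1 hXY
      grind

/-- The codegree of `u` and `v`: the number of their common neighbours. -/
noncomputable def codegree (G : SimpleGraph V) (u v : V) : ℕ :=
  (Finset.univ.filter fun z ↦ G.Adj u z ∧ G.Adj v z).card

/-- The discounted number of pairs `{u, v}` to which the edge `{u, w}` may serve, as part of the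
path `u, w, v`. A nonadjacent pair of codegree `k ≥ K` counts with weight `r ^ (k - K)`. -/
noncomputable def edgeLoad (K : ℕ) (r : ℝ) (G : SimpleGraph V) (u w : V) : ℝ :=
  ∑ v, if G.Adj v w ∧ ¬ G.Adj u v ∧ v ≠ u ∧ K ≤ G.codegree u v then r ^ (G.codegree u v - K) else 0

/-- On `[0, 1]` the convex function `exp (l * t)` lies below its chord, whose slope is less than
`exp l`. -/
lemma exp_mul_le_one_add {l t : ℝ} (h0 : 0 ≤ t) (h1 : t ≤ 1) :
    Real.exp (l * t) ≤ 1 + Real.exp l * t := by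
  have := convexOn_exp.2 (Set.mem_univ l) (Set.mem_univ 0) h0 (sub_nonneg.2 h1) (by ring)
  simp only [smul_eq_mul, mul_zero, add_zero, Real.exp_zero, mul_one] at this
  rw [mul_comm l t]
  linarith

/-- Exponential moment bound for the load of the edge `{u, w}`, given that `u` has at least `m`
neighbours. The loads of the various `v` are independent once the neighbourhood of `u` is
exposed. -/
lemma measureReal_edgeLoad_ge_le {u w : V} (huw : u ≠ w) {X : Finset V}
    (hX : ∀ x, x ∈ X ↔ x ≠ u ∧ x ≠ w) (K : ℕ) {r : ℝ} (hr0 : 0 < r) (hr1 : r ≤ 1)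
    {l T : ℝ} (hl : 0 ≤ l) {m : ℕ} :
    (binomialRandom V p).real {G | (m : ℝ) ≤ (X.filter (G.Adj u)).card ∧
      T ≤ edgeLoad K r G u w} ≤
      Real.exp (Fintype.card V * (Real.exp l / r ^ K * p * (1 - p * (1 - r)) ^ m) - l * T) := by
  have hp0 := p.2.1
  have hp1 := p.2.2
  set c := Real.exp l / r ^ K with hc
  have hc0 : 0 < c := by positivity
  set Y : Finset V → Finset V := fun A ↦ Finset.univ \ (A ∪ {u, w}) with hY
  -- `h A v` bounds the exponential moment factor of `v`, given that `A` is the neighbourhood of `u`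
  let h : Finset V → V → SimpleGraph V → ℝ := fun A v G ↦
    1 + c * ((if G.Adj v w then 1 else 0) * ∏ a ∈ A, if G.Adj v a then r else 1)
  have hh : ∀ A v G, 1 ≤ h A v G := fun A v G ↦ by
    have : 0 ≤ ∏ a ∈ A, if G.Adj v a then r else 1 := Finset.prod_nonneg fun a _ ↦ by positivity
    simp only [h, le_add_iff_nonneg_right]
    positivity
  have hdep : ∀ A v, DependsOnEdges (h A v) (starPairs v (insert w A)) := fun A v ↦
    dependsOnEdges_starPairs fun G H hGH ↦ by
      simp only [h, hGH w (by simp)]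
      rw [Finset.prod_congr rfl fun a ha ↦ by rw [hGH a (by simp [ha])]]
  refine measureReal_le_of_expose p (u := u) (X := X) (m := m)
    (Real.exp_nonneg _) (fun G hG ↦ hG.1)
    (fun A G ↦ Real.exp (-(l * T)) * ∏ v ∈ Y A, h A v G)
    (fun A ↦ ⋃ v ∈ Y A, starPairs v (insert w A)) ?_ ?_ ?_ ?_ ?_
  · exact fun A _ G ↦ mul_nonneg (Real.exp_nonneg _)
      (Finset.prod_nonneg fun v _ ↦ zero_le_one.trans (hh A v G))
  · rintro G ⟨-, hG⟩
    set A := X.filter (G.Adj u) with hA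
    rw [Real.exp_neg, inv_mul_eq_div, one_le_div (Real.exp_pos _)]
    calc Real.exp (l * T) ≤ Real.exp (l * edgeLoad K r G u w) := by gcongr
      _ = ∏ v, Real.exp (l * if G.Adj v w ∧ ¬ G.Adj u v ∧ v ≠ u ∧ K ≤ G.codegree u v then
            r ^ (G.codegree u v - K) else 0) := by
          rw [edgeLoad, Finset.mul_sum, Real.exp_sum]
      _ = ∏ v ∈ Y A, Real.exp (l * if G.Adj v w ∧ ¬ G.Adj u v ∧ v ≠ u ∧ K ≤ G.codegree u v then
            r ^ (G.codegree u v - K) else 0) := by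
          -- only nonneighbours of `u` other than `u` and `w` carry load
          refine (Finset.prod_subset (Finset.subset_univ _) fun v _ hv ↦ ?_).symm
          rw [if_neg, mul_zero, Real.exp_zero]
          rintro ⟨hvw, huv, hvu, -⟩
          have := hvw.ne
          simp [Y, A, hX, huv, hvu, this] at hv
      _ ≤ ∏ v ∈ Y A, h A v G := by
          refine Finset.prod_le_prod (fun v _ ↦ Real.exp_nonneg _) fun v _ ↦ ?_
          split_ifs with hv
          · have h1 : r ^ (G.codegree u v - K) ≤ 1 := pow_le_one₀ hr0.le hr1
            refine (exp_mul_le_one_add (by positivity) h1).trans ?_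
            simp only [h, if_pos hv.1, one_mul]
            rw [pow_sub₀ _ hr0.ne' hv.2.2.2, ← pow_card_filter_eq_prod, hc]
            have h2 : (A.filter (G.Adj v)).card ≤ G.codegree u v :=
              Finset.card_le_card fun z hz ↦ by
                simp only [A, Finset.mem_filter] at hz
                simp [hz.1.2, hz.2]
            have h3 := pow_le_pow_of_le_one hr0.le hr1 h2
            have h4 : Real.exp l * (r ^ G.codegree u v * (r ^ K)⁻¹) ≤
                Real.exp l * (r ^ (A.filter (G.Adj v)).card * (r ^ K)⁻¹) := by gcongr
            calc _ ≤ _ := add_le_add_right h4 1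
              _ = _ := by ring
          · simpa using hh A v G
  · exact fun A _ G H hGH ↦
      congrArg _ (DependsOnEdges.prod (s := Y A) (fun v _ ↦ hdep A v) G H hGH)
  · intro A hA
    simp only [Set.disjoint_iUnion_right]
    intro y hy
    have hyu : u ≠ y := fun h ↦ by simp [Y, h] at hy
    have hu : u ∉ A := fun h ↦ by simpa [hX] using hA h
    exact disjoint_starPairs hyu (.inl (by simp [huw, hu]))
  · intro A hA hm
    have hm' : m ≤ A.card := by exact_mod_cast hm
    rw [integral_const_mul, integral_prod_of_dependsOnEdges p (f := h A) (fun v _ ↦ hdep A v)]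
    · have hq : 0 ≤ 1 - p * (1 - r) := by nlinarith
      have key : ∀ v ∈ Y A, ∫ G, h A v G ∂binomialRandom V p ≤
          Real.exp (c * p * (1 - p * (1 - r)) ^ m) := by
        intro v hv
        simp only [Y, Finset.mem_sdiff, Finset.mem_univ, Finset.mem_union, Finset.mem_insert,
          Finset.mem_singleton, true_and, not_or] at hv
        have hwA : w ∉ A := fun h ↦ by simpa [hX] using hA h
        simp only [h]
        rw [integral_add .of_finite .of_finite, integral_const_mul,
          integral_mul_of_dependsOnEdges p (S := starPairs v {w}) (T := starPairs v A),
          integral_adj_ite p hv.2.2, integral_prod_adj_ite p hv.1]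
        · simp only [integral_const, probReal_univ, smul_eq_mul, mul_one, mul_zero, add_zero]
          have h1 : (1 - p * (1 - r) : ℝ) ^ A.card ≤ (1 - p * (1 - r)) ^ m :=
            pow_le_pow_of_le_one hq (by nlinarith) hm'
          have h2 : c * (p * (1 - p * (1 - r)) ^ A.card) ≤ c * (p * (1 - p * (1 - r)) ^ m) := by
            gcongr
          have h3 := Real.add_one_le_exp (c * p * (1 - p * (1 - r)) ^ m)
          linarith
        · exact dependsOnEdges_starPairs fun G H hGH ↦ by simp [hGH w]
        · refine dependsOnEdges_starPairs fun G H hGH ↦ ?_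
          rw [Finset.prod_congr rfl fun a ha ↦ by rw [hGH a ha]]
        · exact disjoint_starPairs_of_disjoint (Finset.disjoint_singleton_left.2 hwA)
      calc _ ≤ Real.exp (-(l * T)) * ∏ v ∈ Y A, Real.exp (c * p * (1 - p * (1 - r)) ^ m) := by
            refine mul_le_mul_of_nonneg_left (Finset.prod_le_prod (fun v _ ↦ ?_) key)
              (Real.exp_nonneg _)
            exact integral_nonneg fun G ↦ zero_le_one.trans (hh A v G)
        _ = Real.exp ((Y A).card * (c * p * (1 - p * (1 - r)) ^ m) - l * T) := by
            rw [Finset.prod_const, ← Real.exp_nat_mul, ← Real.exp_add]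
            congr 1
            ring
        _ ≤ _ := by
            have : ((Y A).card : ℝ) ≤ Fintype.card V := by exact_mod_cast Finset.card_le_univ _
            gcongr
    · intro y hy y' hy' hyy'
      refine disjoint_starPairs hyy' (.inl ?_)
      simp only [Y, Finset.coe_sdiff, Set.mem_sdiff, Finset.mem_coe] at hy
      grind

/-! ### Pairs with few common neighbours -/

lemma integral_one_add_adj_mul {z u : V} (hzu : z ≠ u) {A : Finset V} (huA : u ∉ A)
    {g : SimpleGraph V → ℝ} (hg : DependsOnEdges g (starPairs z A)) :
    ∫ G, (1 + (if G.Adj z u then 1 else 0) * (g G - 1)) ∂binomialRandom V p =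
      1 + p * (∫ G, g G ∂binomialRandom V p - 1) := by
  rw [integral_add .of_finite .of_finite,
    integral_mul_of_dependsOnEdges p (S := starPairs z {u}) (T := starPairs z A),
    integral_adj_ite p hzu, integral_sub .of_finite .of_finite]
  · simp
  · exact dependsOnEdges_starPairs fun G H hGH ↦ by simp [hGH u]
  · exact fun G H hGH ↦ by rw [hg G H hGH]
  · exact disjoint_starPairs_of_disjoint (Finset.disjoint_singleton_left.2 huA)

lemma integral_adj_and_adj_ite {z u v : V} (hzu : z ≠ u) (hzv : z ≠ v) (huv : u ≠ v) (s : ℝ) :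
    ∫ G : SimpleGraph V, (if G.Adj z u ∧ G.Adj z v then s else 1) ∂binomialRandom V p =
      1 - p ^ 2 * (1 - s) := by
  have h : ∀ G : SimpleGraph V, (if G.Adj z u ∧ G.Adj z v then s else 1) =
      1 + (if G.Adj z u then 1 else 0) * ((if G.Adj z v then s else 1) - 1) := fun G ↦ by
    split_ifs <;> simp_all
  simp only [h]
  rw [integral_one_add_adj_mul p hzu (A := {v}) (by simpa), integral_adj_ite p hzv]
  · ring
  · exact dependsOnEdges_starPairs fun G H hGH ↦ by simp [hGH v]

lemma card_filter_adj_le_codegree (G : SimpleGraph V) (Z : Finset V) (u v : V) :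
    (Z.filter fun z ↦ G.Adj z u ∧ G.Adj z v).card ≤ G.codegree u v :=
  Finset.card_le_card fun z hz ↦ by
    simp only [Finset.mem_filter, Finset.mem_univ, true_and] at hz ⊢
    exact ⟨hz.2.1.symm, hz.2.2.symm⟩

/-- Two disjoint pairs both have small codegree with probability at most about
`exp (-2 (1 - s) n p ^ 2)`, also jointly with an independent event `D`. -/
lemma measureReal_two_disjoint_codegree_lt_le [DecidableEq V] {u v x y : V} (huv : u ≠ v)
    (hxy : x ≠ y) (hux : u ≠ x) (huy : u ≠ y) (hvx : v ≠ x) (hvy : v ≠ y) (K : ℕ) {s : ℝ} (hs0 : 0 < s)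
    (hs1 : s ≤ 1) {Z : Finset V} (hZ : Disjoint Z {u, v, x, y}) {D : SimpleGraph V → Prop}
    {S : Set (Sym2 V)} (hD : DependsOnEdges D S)
    (hSZ : ∀ z ∈ Z, Disjoint S (starPairs z {u, v, x, y})) :
    (binomialRandom V p).real {G | D G ∧ G.codegree u v < K ∧ G.codegree x y < K} ≤
      (binomialRandom V p).real {G | D G} *
        ((s ^ (2 * K))⁻¹ * ((1 - p ^ 2 * (1 - s)) ^ 2) ^ Z.card) := by
  have hZ' : ∀ z ∈ Z, z ≠ u ∧ z ≠ v ∧ z ≠ x ∧ z ≠ y := fun z hz ↦ by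
    simpa using Finset.disjoint_left.1 hZ hz
  let h : V → SimpleGraph V → ℝ := fun z G ↦
    (if G.Adj z u ∧ G.Adj z v then s else 1) * if G.Adj z x ∧ G.Adj z y then s else 1
  have hdep : ∀ z, DependsOnEdges (h z) (starPairs z {u, v, x, y}) := fun z ↦
    dependsOnEdges_starPairs fun G H hGH ↦ by
      simp only [h, hGH u (by simp), hGH v (by simp), hGH x (by simp), hGH y (by simp)]
  have hh : ∀ z G, 0 ≤ h z G := fun z G ↦ by simp only [h]; positivity
  calc _ ≤ ∫ G, (if D G then 1 else 0) * ((s ^ (2 * K))⁻¹ * ∏ z ∈ Z, h z G)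
        ∂binomialRandom V p := by
        refine measureReal_le_integral p (fun G ↦ ?_) fun G hG ↦ ?_
        · have := Finset.prod_nonneg fun z (_ : z ∈ Z) ↦ hh z G
          positivity
        · rw [if_pos hG.1, one_mul, inv_mul_eq_div, one_le_div (by positivity)]
          simp only [h]
          rw [Finset.prod_mul_distrib, ← pow_card_filter_eq_prod, ← pow_card_filter_eq_prod,
            ← pow_add]
          refine pow_le_pow_of_le_one hs0.le hs1 ?_
          have h1 := card_filter_adj_le_codegree G Z u v
          have h2 := card_filter_adj_le_codegree G Z x y
          have := hG.2
          omega
    _ = (∫ G, (if D G then 1 else 0) ∂binomialRandom V p) *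
          ((s ^ (2 * K))⁻¹ * ∏ z ∈ Z, ∫ G, h z G ∂binomialRandom V p) := by
        rw [integral_mul_of_dependsOnEdges p (S := S) (T := ⋃ z ∈ Z, starPairs z {u, v, x, y}),
          integral_const_mul, integral_prod_of_dependsOnEdges p fun z _ ↦ hdep z]
        · intro z hz z' hz' hzz'
          exact disjoint_starPairs hzz' (.inl (Finset.disjoint_left.1 hZ hz))
        · exact fun G H hGH ↦ by rw [hD G H hGH]
        · exact fun G H hGH ↦ congrArg _ (DependsOnEdges.prod (s := Z) (fun z _ ↦ hdep z) G H hGH)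
        · simpa only [Set.disjoint_iUnion_right] using hSZ
    _ = _ := by
        congr 1
        · rw [← integral_indicator_one (.of_discrete)]
          congr with G
        · congr 1
          refine Finset.prod_eq_pow_card fun z hz ↦ ?_
          obtain ⟨hzu, hzv, hzx, hzy⟩ := hZ' z hz
          simp only [h]
          rw [integral_mul_of_dependsOnEdges p (S := starPairs z {u, v}) (T := starPairs z {x, y}),
            integral_adj_and_adj_ite p hzu hzv huv, integral_adj_and_adj_ite p hzx hzy hxy]
          · ring
          · exact dependsOnEdges_starPairs fun G H hGH ↦ by simp [hGH u, hGH v]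
          · exact dependsOnEdges_starPairs fun G H hGH ↦ by simp [hGH x, hGH y]
          · exact disjoint_starPairs_of_disjoint (by simp [*, Ne.symm])

/-- Two pairs sharing the vertex `u` both have small codegree with probability at most about
`exp (-2 (1 - s) n p ^ 2)`. -/
lemma measureReal_two_meeting_codegree_lt_le [DecidableEq V] {u v w : V} (huv : u ≠ v)
    (huw : u ≠ w) (hvw : v ≠ w)
    (K : ℕ) {s : ℝ} (hs0 : 0 < s) (hs1 : s ≤ 1) :
    (binomialRandom V p).real {G | G.codegree u v < K ∧ G.codegree u w < K} ≤
      (s ^ (2 * K))⁻¹ *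
        (1 + p * ((1 - p * (1 - s)) ^ 2 - 1)) ^ ((Finset.univ : Finset V) \ {u, v, w}).card := by
  set Z := (Finset.univ : Finset V) \ {u, v, w} with hZ
  let h : V → SimpleGraph V → ℝ := fun z G ↦
    1 + (if G.Adj z u then 1 else 0) * ((∏ a ∈ {v, w}, if G.Adj z a then s else 1) - 1)
  have hprod : ∀ z, DependsOnEdges (fun G : SimpleGraph V ↦
      ∏ a ∈ {v, w}, if G.Adj z a then s else 1) (starPairs z {v, w}) := fun z ↦
    dependsOnEdges_starPairs fun G H hGH ↦ by
      rw [Finset.prod_congr rfl fun a ha ↦ by rw [hGH a ha]]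
  have hh : ∀ z G, h z G =
      (if G.Adj z u ∧ G.Adj z v then s else 1) * if G.Adj z u ∧ G.Adj z w then s else 1 :=
    fun z G ↦ by
      simp only [h, Finset.prod_pair hvw]
      by_cases hzu : G.Adj z u <;> simp [hzu]
  calc _ ≤ ∫ G, (s ^ (2 * K))⁻¹ * ∏ z ∈ Z, h z G ∂binomialRandom V p := by
        refine measureReal_le_integral p (fun G ↦ ?_) fun G hG ↦ ?_
        · refine mul_nonneg (by positivity) (Finset.prod_nonneg fun z _ ↦ ?_)
          rw [hh]
          positivity
        · rw [inv_mul_eq_div, one_le_div (by positivity)]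
          simp only [hh]
          rw [Finset.prod_mul_distrib, ← pow_card_filter_eq_prod, ← pow_card_filter_eq_prod,
            ← pow_add]
          refine pow_le_pow_of_le_one hs0.le hs1 ?_
          have h1 := card_filter_adj_le_codegree G Z u v
          have h2 := card_filter_adj_le_codegree G Z u w
          have := hG.1
          have := hG.2
          omega
    _ = _ := by
        rw [integral_const_mul, integral_prod_of_dependsOnEdges p (f := h)
          (S := fun z ↦ starPairs z {u, v, w})]
        · congr 1
          refine Finset.prod_eq_pow_card fun z hz ↦ ?_
          simp only [hZ, Finset.mem_sdiff, Finset.mem_univ, Finset.mem_insert,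
            Finset.mem_singleton, true_and, not_or] at hz
          simp only [h]
          rw [integral_one_add_adj_mul p hz.1 (A := {v, w}) (by simp [huv, huw]) (hprod z),
            integral_prod_adj_ite p (by simp [hz.2]), Finset.card_pair hvw]
        · intro z _
          refine dependsOnEdges_starPairs fun G H hGH ↦ ?_
          simp only [hh, hGH u (by simp), hGH v (by simp), hGH w (by simp)]
        · intro z hz z' hz' hzz'
          simp only [hZ, Finset.coe_sdiff, Set.mem_sdiff, Finset.mem_coe] at hz
          exact disjoint_starPairs hzz' (.inl hz.2)

end Estimates

/-! ### Counting partial solutions of a constraint system -/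

section Counting

open Finset

variable {E ι : Type*} [DecidableEq E] [Fintype ι]

/-- The subsets of `S` satisfying every constraint `i` whose domain `D i` lies in `S`, where a set `R`
violates constraint `i` if its trace on `D i` is in `Bad i`. -/
def validSubsets (D : ι → Finset E) (Bad : ι → Finset (Finset E)) (S : Finset E) :
    Finset (Finset E) :=
  S.powerset.filter fun R ↦ ∀ i, D i ⊆ S → R ∩ D i ∉ Bad i

variable {D : ι → Finset E} {Bad : ι → Finset (Finset E)} {β : ℝ}

lemma mem_validSubsets {S R : Finset E} :
    R ∈ validSubsets D Bad S ↔ R ⊆ S ∧ ∀ i, D i ⊆ S → R ∩ D i ∉ Bad i := by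
  simp [validSubsets]

/-- If adding any single element to a proper subset of `S` multiplies the number of valid subsets by
at least `β`, then removing the elements of `W` from `S` divides it by at least `β ^ #W`. -/
lemma pow_mul_card_validSubsets_sdiff_le (hβ : 0 ≤ β) {S : Finset E}
    (h : ∀ S' ⊂ S, ∀ e ∉ S', β * #(validSubsets D Bad S') ≤ #(validSubsets D Bad (insert e S')))
    (W : Finset E) (hW : W ⊆ S) :
    β ^ #W * #(validSubsets D Bad (S \ W)) ≤ #(validSubsets D Bad S) := by
  induction W using Finset.induction_on with
  | empty => simp
  | insert a W ha ih =>
    have haS : a ∈ S := hW (by simp)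
    have h1 := h (S \ insert a W) (by grind) a (by simp)
    rw [show insert a (S \ insert a W) = S \ W by grind] at h1
    rw [card_insert_of_notMem ha, pow_succ, mul_assoc]
    exact (mul_le_mul_of_nonneg_left h1 (by positivity)).trans (ih (by grind))

/-- The violations of constraint `i` among the extensions of valid subsets by `e`. Such an extension
is determined by its bad trace on `D i` and by the rest, which is a valid subset of `S \ D i`. -/
lemma card_filter_bad_le {S : Finset E} {e : E} {X : Finset (Finset E)}
    (hX : ∀ R ∈ X, R.erase e ∈ validSubsets D Bad S) {i : ι} (hei : e ∈ D i) :
    #(X.filter fun R ↦ R ∩ D i ∈ Bad i) ≤ #(Bad i) * #(validSubsets D Bad (S \ D i)) := by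
  rw [← card_product]
  refine card_le_card_of_injOn (fun R ↦ (R ∩ D i, R \ D i)) (fun R hR ↦ ?_) fun R _ R' _ hRR' ↦ ?_
  · simp only [coe_filter, Set.mem_ofPred_eq] at hR
    obtain ⟨h1, h2⟩ := mem_validSubsets.1 (hX R hR.1)
    simp only [coe_product, Set.mem_prod, mem_coe]
    refine ⟨hR.2, mem_validSubsets.2 ⟨by grind, fun j hj ↦ ?_⟩⟩
    rw [show R \ D i ∩ D j = R.erase e ∩ D j by grind]
    exact h2 j (by grind)
  · simp only [Prod.mk.injEq] at hRR'
    rw [← sdiff_union_inter R (D i), ← sdiff_union_inter R' (D i), hRR'.1, hRR'.2]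

/-- The counting induction: each valid subset of `S` has two extensions by `e`, and at most a
fraction `2 - β` as many extensions as valid subsets violate a constraint involving `e`. -/
lemma mul_card_validSubsets_le [DecidableEq ι] (hβ : 0 < β)
    (h : ∀ e, ∑ i with e ∈ D i, (#(Bad i) : ℝ) / β ^ (#(D i) - 1) ≤ 2 - β) (S : Finset E) :
    ∀ e ∉ S, β * #(validSubsets D Bad S) ≤ #(validSubsets D Bad (insert e S)) := by
  induction S using Finset.strongInduction with
  | H S ih =>
  intro e he
  set N := validSubsets D Bad S
  -- the extensions of valid subsets by `e`, in or out
  set X := N ∪ N.image (insert e) with hX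
  have hNS : ∀ R ∈ N, R ⊆ S := fun R hR ↦ (mem_validSubsets.1 hR).1
  have hXcard : #X = 2 * #N := by
    rw [hX, card_union_of_disjoint, card_image_of_injOn, two_mul]
    · intro R hR R' hR' hRR'
      have h1 := hNS R hR
      have h2 := hNS R' hR'
      rw [← erase_insert (fun h ↦ he (h1 h)), ← erase_insert (fun h ↦ he (h2 h)), hRR']
    · rw [Finset.disjoint_left]
      intro R hR hR'
      obtain ⟨R', -, rfl⟩ := mem_image.1 hR'
      exact he (hNS _ hR (mem_insert_self _ _))
  have hXe : ∀ R ∈ X, R.erase e ∈ N := by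
    intro R hR
    rcases mem_union.1 hR with hR | hR
    · rwa [erase_eq_of_notMem fun h ↦ he (hNS R hR h)]
    · obtain ⟨R', hR', rfl⟩ := mem_image.1 hR
      rwa [erase_insert fun h ↦ he (hNS R' hR' h)]
  set J : Finset ι := univ.filter fun i ↦ e ∈ D i
  have hcover : X ⊆ validSubsets D Bad (insert e S) ∪
      (J.filter fun i ↦ D i ⊆ insert e S).biUnion fun i ↦ X.filter fun R ↦ R ∩ D i ∈ Bad i := by
    intro R hR
    obtain ⟨h1, h2⟩ := mem_validSubsets.1 (hXe R hR)
    by_contra hcon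
    simp only [mem_union, mem_biUnion, mem_filter, J, mem_univ, true_and, not_or, not_exists,
      mem_validSubsets, not_and, hR, not_forall, not_not] at hcon
    obtain ⟨i, hi, hb⟩ := hcon.1 (by grind)
    by_cases hei : e ∈ D i
    · exact hcon.2 i ⟨hei, hi⟩ hb
    · refine h2 i (by grind) ?_
      rwa [show R.erase e ∩ D i = R ∩ D i by grind]
  have hbad : ∀ i ∈ J.filter fun i ↦ D i ⊆ insert e S,
      (#(X.filter fun R ↦ R ∩ D i ∈ Bad i) : ℝ) ≤ #(Bad i) / β ^ (#(D i) - 1) * #N := by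
    intro i hi
    simp only [mem_filter, J, mem_univ, true_and] at hi
    have h1 := card_filter_bad_le hXe hi.1
    have h2 := pow_mul_card_validSubsets_sdiff_le hβ.le ih ((D i).erase e) (by grind)
    rw [card_erase_of_mem hi.1, show S \ (D i).erase e = S \ D i by grind] at h2
    calc _ ≤ (#(Bad i) * #(validSubsets D Bad (S \ D i)) : ℝ) := by exact_mod_cast h1
      _ ≤ #(Bad i) * (#N / β ^ (#(D i) - 1)) := by
          gcongr
          rwa [le_div_iff₀ (by positivity), mul_comm]
      _ = _ := by ring
  have hsum : (2 * #N : ℝ) ≤ #(validSubsets D Bad (insert e S)) + (2 - β) * #N := by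
    calc (2 * #N : ℝ) = #X := by rw [hXcard]; push_cast; rfl
      _ ≤ #(validSubsets D Bad (insert e S)) + ∑ i ∈ J.filter fun i ↦ D i ⊆ insert e S,
            (#(X.filter fun R ↦ R ∩ D i ∈ Bad i) : ℝ) := by
          exact_mod_cast (card_le_card hcover).trans <|
            (card_union_le _ _).trans (add_le_add_right card_biUnion_le _)
      _ ≤ #(validSubsets D Bad (insert e S)) +
            ∑ i ∈ J, #(Bad i) / β ^ (#(D i) - 1) * (#N : ℝ) := by
          gcongr
          exact (sum_le_sum hbad).trans
            (sum_le_sum_of_subset_of_nonneg (filter_subset _ _) fun i _ _ ↦ by positivity)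
      _ ≤ _ := by
          rw [← sum_mul]
          gcongr
          exact h e
  linarith

/-- A weighted counting criterion for satisfying all constraints at once: adding one element to the
ground set multiplies the number of valid subsets by at least `β`. -/
theorem exists_forall_inter_notMem [Fintype E] [DecidableEq ι] (hβ : 0 < β)
    (hD : ∀ i, D i = ∅ → Bad i = ∅)
    (h : ∀ e, ∑ i with e ∈ D i, (#(Bad i) : ℝ) / β ^ (#(D i) - 1) ≤ 2 - β) :
    ∃ R : Finset E, ∀ i, R ∩ D i ∉ Bad i := by
  have h0 : #(validSubsets D Bad ∅) = 1 := by
    rw [card_eq_one]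
    refine ⟨∅, ext fun R ↦ ?_⟩
    simp only [mem_validSubsets, subset_empty, mem_singleton, and_iff_left_iff_imp]
    exact fun _ i hi ↦ by simp [hD i hi]
  have h1 := pow_mul_card_validSubsets_sdiff_le (Bad := Bad) hβ.le
    (fun S' _ ↦ mul_card_validSubsets_le hβ h S') (univ : Finset E) subset_rfl
  rw [sdiff_self, bot_eq_empty, h0] at h1
  have h2 : 0 < #(validSubsets D Bad univ) := by
    have : (0 : ℝ) < β ^ #(univ : Finset E) * (1 : ℕ) := by positivity
    exact_mod_cast this.trans_le h1
  obtain ⟨R, hR⟩ := card_pos.1 h2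
  exact ⟨R, fun i ↦ (mem_validSubsets.1 hR).2 i (subset_univ _)⟩

end Counting

/-! ### Rainbow colourings and the diameter -/

section Rainbow

variable {V : Type*} {G : SimpleGraph V}

/-- A rainbow path has at most as many edges as there are colours. -/
lemma EdgeLabeling.IsRainbow.ediam_le {k : ℕ} {C : G.EdgeLabeling (Fin k)} (hC : C.IsRainbow) :
    G.ediam ≤ k := by
  refine ediam_le_of_edist_le fun u v ↦ ?_
  obtain ⟨w, hw, hinj⟩ := hC u v
  refine (edist_le w).trans ?_
  have hnd : (w.edges.attach.map fun e ↦ C ⟨e.1, w.edges_subset_edgeSet e.2⟩).Nodup := by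
    refine (List.nodup_attach.2 hw.isTrail.edges_nodup).map_on fun e _ e' _ hee' ↦ ?_
    have := hinj (x₁ := ⟨e.1, w.edges_subset_edgeSet e.2⟩)
      (x₂ := ⟨e'.1, w.edges_subset_edgeSet e'.2⟩) e.2 e'.2 hee'
    exact Subtype.ext (congrArg (fun e : G.edgeSet ↦ (e : Sym2 V)) this)
  have := hnd.length_le_card
  simp only [List.length_map, List.length_attach, Walk.length_edges, Fintype.card_fin] at this
  exact_mod_cast this

variable (G) in
lemma ediam_le_rainbowConnectionNumber : G.ediam ≤ G.rainbowConnectionNumber :=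
  le_iInf₂ fun _ ⟨_, hC⟩ ↦ hC.ediam_le

lemma EdgeLabeling.IsRainbow.rainbowConnectionNumber_le {k : ℕ} {C : G.EdgeLabeling (Fin k)}
    (hC : C.IsRainbow) : G.rainbowConnectionNumber ≤ k :=
  iInf₂_le k ⟨C, hC⟩

/-- A colouring of all pairs, restricted to the edges of `G`. -/
def restrictLabeling {K : Type*} (G : SimpleGraph V) (c : Sym2 V → K) : G.EdgeLabeling K :=
  fun e ↦ c e

lemma isRainbowPath_of_nodup {K : Type*} {c : Sym2 V → K} {u v : V} {w : G.Walk u v}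
    (hw : w.IsPath) (h : (w.edges.map c).Nodup) : w.IsRainbowPath (G.restrictLabeling c) :=
  ⟨hw, fun _ ha _ hb hab ↦ Subtype.ext (List.inj_on_of_nodup_map h ha hb hab)⟩

/-- Vertices `u` and `v` are joined by a rainbow path of length at most two. -/
def RainbowTwo {K : Type*} (G : SimpleGraph V) (c : Sym2 V → K) (u v : V) : Prop :=
  G.Adj u v ∨ ∃ w, G.Adj u w ∧ G.Adj w v ∧ c s(u, w) ≠ c s(w, v)

lemma isRainbow_restrictLabeling {K : Type*} {c : Sym2 V → K}
    (h : ∀ u v, u ≠ v → G.RainbowTwo c u v ∨ ∃ x y, x ≠ v ∧ y ≠ u ∧ G.Adj u x ∧ G.Adj x y ∧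
      G.Adj y v ∧ c s(u, x) ≠ c s(x, y) ∧ c s(x, y) ≠ c s(y, v) ∧ c s(u, x) ≠ c s(y, v)) :
    (G.restrictLabeling c).IsRainbow := by
  intro u v
  by_cases huv : u = v
  · subst huv
    exact ⟨.nil, isRainbowPath_of_nodup (by simp) (by simp)⟩
  rcases h u v huv with (h | ⟨w, h1, h2, h3⟩) | ⟨x, y, hxv, hyu, h1, h2, h3, h4, h5, h6⟩
  · exact ⟨.cons h .nil, isRainbowPath_of_nodup (by simp [huv]) (by simp)⟩
  · exact ⟨.cons h1 (.cons h2 .nil),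
      isRainbowPath_of_nodup (by simp [huv, h1.ne, h2.ne]) (by simp [h3])⟩
  · exact ⟨.cons h1 (.cons h2 (.cons h3 .nil)), isRainbowPath_of_nodup
      (by simp [huv, h1.ne, h2.ne, h3.ne, hxv, hyu.symm]) (by simp [h4, h5, h6])⟩

end Rainbow

/-! ### A colouring of the complete graph with three colours -/

section ThreeColours

/-- Colour the pair `{x, y}` by `x + y` modulo three. -/
def sumColour (n : ℕ) : Sym2 (Fin n) → Fin 3 :=
  Sym2.lift ⟨fun x y ↦ Fin.ofNat 3 (x.val + y.val), fun x y ↦ by simp only [add_comm]⟩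

/-- The vertices other than `u` and `v` which are congruent to `a` modulo three. -/
def residueClass {n : ℕ} (a : ℕ) (u v : Fin n) : Finset (Fin n) :=
  Finset.univ.filter fun x ↦ x.val % 3 = a ∧ x ≠ u ∧ x ≠ v

/-- Between the residue classes `i` of `u` and `j` of `v`, the path `u, x, y, v` with `x ≡ a` and
`y ≡ b` has colours `i + a`, `a + b`, `b + j`. For suitable `a ≠ b` these are distinct. -/
lemma rainbowConnectionNumber_le_three {n : ℕ} {G : SimpleGraph (Fin n)}
    (h : ∀ u v : Fin n, u ≠ v → ∀ a < 3, ∀ b < 3, a ≠ b →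
      ∃ x ∈ residueClass a u v, ∃ y ∈ residueClass b u v, G.Adj u x ∧ G.Adj x y ∧ G.Adj y v) :
    G.rainbowConnectionNumber ≤ 3 := by
  refine (isRainbow_restrictLabeling (c := sumColour n) fun u v huv ↦ .inr
    ?_).rainbowConnectionNumber_le
  -- `a = i`, `b = j` if `i ≠ j`, and otherwise the two residues other than `i`
  have key : ∀ i < 3, ∀ j < 3, ∃ a < 3, ∃ b < 3, a ≠ b ∧ (i + a) % 3 ≠ (a + b) % 3 ∧
      (a + b) % 3 ≠ (b + j) % 3 ∧ (i + a) % 3 ≠ (b + j) % 3 := by decide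
  obtain ⟨a, ha, b, hb, hab, h1, h2, h3⟩ :=
    key (u.val % 3) (Nat.mod_lt _ (by simp)) (v.val % 3) (Nat.mod_lt _ (by simp))
  obtain ⟨x, hx, y, hy, hux, hxy, hyv⟩ := h u v huv a ha b hb hab
  simp only [residueClass, Finset.mem_filter, Finset.mem_univ, true_and] at hx hy
  refine ⟨x, y, hx.2.2, hy.2.1, hux, hxy, hyv, ?_, ?_, ?_⟩ <;>
    simp only [sumColour, Sym2.lift_mk, ne_eq, Fin.ext_iff, Fin.ofNat] <;> omega

end ThreeColours

/-! ### Two colours for graphs of diameter two -/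

section TwoColours

open Classical Finset

variable {V : Type*} [Fintype V]

/-- A thin pair: two distinct nonadjacent vertices with fewer than `K` common neighbours. -/
def IsThin (G : SimpleGraph V) (K : ℕ) (u v : V) : Prop :=
  u ≠ v ∧ ¬ G.Adj u v ∧ G.codegree u v < K

variable {G : SimpleGraph V} {K : ℕ}

lemma codegree_comm (G : SimpleGraph V) (u v : V) : G.codegree u v = G.codegree v u := by
  simp only [codegree, and_comm]

lemma IsThin.symm {u v : V} (h : G.IsThin K u v) : G.IsThin K v u :=
  ⟨h.1.symm, fun h' ↦ h.2.1 h'.symm, by rw [codegree_comm]; exact h.2.2⟩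

/-- The thin pairs are scattered: distinct ones are disjoint, not joined by an edge, and
without a vertex adjacent to all four of their members. -/
structure ThinPairsScattered (G : SimpleGraph V) (K : ℕ) : Prop where
  eq_of_meet : ∀ u v w, G.IsThin K u v → G.IsThin K u w → v = w
  not_adj : ∀ u v x y, G.IsThin K u v → G.IsThin K x y → u ≠ x → u ≠ y → v ≠ x → v ≠ y →
    ¬ G.Adj u x
  not_common : ∀ w u v x y, G.IsThin K u v → G.IsThin K x y → u ≠ x → u ≠ y → v ≠ x → v ≠ y →
    ¬ (G.Adj w u ∧ G.Adj w v ∧ G.Adj w x ∧ G.Adj w y)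

section Centres

variable {m : V → V → V}

/-- The edges of the paths `u, m u v, v` through the chosen centres of the thin pairs. -/
def reservedEdges (G : SimpleGraph V) (K : ℕ) (m : V → V → V) : Set (Sym2 V) :=
  {e | ∃ u v, G.IsThin K u v ∧ e = s(u, m u v)}

/-- A reserved edge determines its thin pair together with the endpoint that it contains. -/
lemma ThinPairsScattered.eq_of_reserved (h : G.ThinPairsScattered K)
    (hm : ∀ u v, G.IsThin K u v → G.Adj u (m u v) ∧ G.Adj v (m u v)) {u v x y : V}
    (huv : G.IsThin K u v) (hxy : G.IsThin K x y) (he : s(u, m u v) = s(x, m x y)) :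
    u = x ∧ v = y := by
  rcases Sym2.eq_iff.1 he with ⟨rfl, -⟩ | ⟨h1, h2⟩
  · exact ⟨rfl, h.eq_of_meet _ _ _ huv hxy⟩
  · exfalso
    have a1 := hm u v huv
    have a2 := hm x y hxy
    rw [h2] at a1
    rw [← h1] at a2
    refine h.not_adj u v x y huv hxy a1.1.ne a2.2.ne' a1.2.ne ?_ a1.1
    rintro rfl
    exact a1.1.ne (h.eq_of_meet _ _ _ huv.symm hxy.symm)

/-- A vertex is a member of at most one thin pair, and the centre of at most one, which gives at
most three reserved edges at it. -/
lemma ThinPairsScattered.card_reserved_le (h : G.ThinPairsScattered K)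
    (hm : ∀ u v, G.IsThin K u v → G.Adj u (m u v) ∧ G.Adj v (m u v)) (u : V) :
    #{z | s(u, z) ∈ reservedEdges G K m} ≤ 3 := by
  obtain ⟨a, ha⟩ : ∃ a, ∀ v, G.IsThin K u v → m u v = a := by
    by_cases hv : ∃ v, G.IsThin K u v
    · obtain ⟨v, hv⟩ := hv
      exact ⟨m u v, fun v' hv' ↦ by rw [h.eq_of_meet _ _ _ hv hv']⟩
    · exact ⟨u, fun v hv' ↦ absurd ⟨v, hv'⟩ hv⟩
  obtain ⟨b, c, hbc⟩ : ∃ b c, ∀ x y, G.IsThin K x y → u = m x y → x = b ∨ x = c := by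
    by_cases hv : ∃ b c, G.IsThin K b c ∧ u = m b c
    · obtain ⟨b, c, hb, hu⟩ := hv
      refine ⟨b, c, fun x y hxy hu' ↦ ?_⟩
      by_contra! hcon
      have a1 := hm b c hb
      have a2 := hm x y hxy
      rw [← hu] at a1
      rw [← hu'] at a2
      refine h.not_common u b c x y hb hxy hcon.1.symm ?_ hcon.2.symm ?_
        ⟨a1.1.symm, a1.2.symm, a2.1.symm, a2.2.symm⟩
      · rintro rfl
        exact hcon.2 (h.eq_of_meet _ _ _ hxy.symm hb)
      · rintro rfl
        exact hcon.1 (h.eq_of_meet _ _ _ hxy.symm hb.symm)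
    · exact ⟨u, u, fun x y hxy hu' ↦ absurd ⟨x, y, hxy, hu'⟩ hv⟩
  refine (card_le_card (t := {a, b, c}) fun z hz ↦ ?_).trans card_le_three
  simp only [mem_filter, mem_univ, true_and] at hz
  obtain ⟨x, y, hxy, he⟩ := hz
  rcases Sym2.eq_iff.1 he with ⟨rfl, rfl⟩ | ⟨h1, rfl⟩
  · simp [ha y hxy]
  · rcases hbc z y hxy h1 with rfl | rfl <;> simp

end Centres

/-- The common neighbours `z` of `u` and `v` for which neither `{u, z}` nor `{v, z}` is in `P`. -/
noncomputable def freeCommon (G : SimpleGraph V) (P : Set (Sym2 V)) (u v : V) : Finset V :=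
  {z | G.Adj u z ∧ G.Adj v z ∧ s(u, z) ∉ P ∧ s(v, z) ∉ P}

/-- The edges `{u, z}` and `{v, z}` with `z` a free common neighbour. -/
noncomputable def freeEdges (G : SimpleGraph V) (P : Set (Sym2 V)) (u v : V) : Finset (Sym2 V) :=
  (freeCommon G P u v).image (fun z ↦ s(u, z)) ∪ (freeCommon G P u v).image fun z ↦ s(v, z)

/-- The two-colourings of the free edges, given by one of the colour classes, in which every path
`u, z, v` is monochromatic. -/
noncomputable def monochromaticSets (G : SimpleGraph V) (P : Set (Sym2 V)) (u v : V) :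
    Finset (Finset (Sym2 V)) :=
  (freeEdges G P u v).powerset.filter fun R ↦
    ∀ z ∈ freeCommon G P u v, s(u, z) ∈ R ↔ s(v, z) ∈ R

lemma card_freeEdges {P : Set (Sym2 V)} {u v : V} (huv : u ≠ v) :
    #(freeEdges G P u v) = 2 * #(freeCommon G P u v) := by
  have hinj : ∀ u : V, Function.Injective fun z ↦ s(u, z) := fun u z z' h ↦ by
    rcases Sym2.eq_iff.1 h with ⟨-, h⟩ | ⟨h1, h2⟩
    exacts [h, h2.trans h1]
  rw [freeEdges, card_union_of_disjoint, card_image_of_injective _ (hinj u),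
    card_image_of_injective _ (hinj v), two_mul]
  rw [Finset.disjoint_left]
  intro e he he'
  simp only [mem_image, freeCommon, mem_filter, mem_univ, true_and] at he he'
  obtain ⟨z, hz, rfl⟩ := he
  obtain ⟨z', hz', he⟩ := he'
  rcases Sym2.eq_iff.1 he with ⟨h, -⟩ | ⟨h, -⟩
  · exact huv h.symm
  · exact hz.2.1.ne h

lemma card_monochromaticSets_le (P : Set (Sym2 V)) (u v : V) :
    #(monochromaticSets G P u v) ≤ 2 ^ #(freeCommon G P u v) := by
  rw [← card_powerset]
  refine card_le_card_of_injOn (fun R ↦ (freeCommon G P u v).filter fun z ↦ s(u, z) ∈ R)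
    (fun R _ ↦ mem_coe.2 (mem_powerset.2 (filter_subset _ _))) fun R hR R' hR' hRR' ↦ ?_
  simp only [monochromaticSets, coe_filter, mem_powerset, Set.mem_ofPred_eq] at hR hR'
  have key : ∀ z ∈ freeCommon G P u v, s(u, z) ∈ R ↔ s(u, z) ∈ R' := fun z hz ↦ by
    simpa [hz] using Finset.ext_iff.1 hRR' z
  have key2 : ∀ e ∈ freeEdges G P u v, e ∈ R ↔ e ∈ R' := by
    intro e he
    simp only [freeEdges, mem_union, mem_image] at he
    rcases he with ⟨z, hz, rfl⟩ | ⟨z, hz, rfl⟩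
    · exact key z hz
    · rw [← hR.2 z hz, ← hR'.2 z hz, key z hz]
  exact Finset.ext fun e ↦ ⟨fun he ↦ (key2 e (hR.1 he)).1 he, fun he ↦ (key2 e (hR'.1 he)).2 he⟩

lemma codegree_le_card_freeCommon_add {P : Set (Sym2 V)} (hP : ∀ u, #{z | s(u, z) ∈ P} ≤ 3)
    (u v : V) : G.codegree u v ≤ #(freeCommon G P u v) + 6 := by
  calc G.codegree u v ≤ #(freeCommon G P u v ∪
        (univ.filter (fun z ↦ s(u, z) ∈ P) ∪ univ.filter fun z ↦ s(v, z) ∈ P)) := by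
        refine card_le_card fun z hz ↦ ?_
        simp only [mem_filter, mem_univ, true_and, mem_union, freeCommon] at hz ⊢
        tauto
    _ ≤ _ := (card_union_le _ _).trans (by
        have := card_union_le (univ.filter (fun z ↦ s(u, z) ∈ P)) (univ.filter fun z ↦ s(v, z) ∈ P)
        have := hP u
        have := hP v
        omega)

/-- If each vertex is incident with few pairs of `P` and the edge loads are small, then some
colouring of the pairs makes a non-monochromatic path avoiding `P` between any two
nonadjacent vertices with at least `K` common neighbours. -/
lemma exists_bicoloured_of_edgeLoad_le {P : Set (Sym2 V)} (hP : ∀ u, #{z | s(u, z) ∈ P} ≤ 3)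
    {β T : ℝ} (hβ0 : 1 ≤ β) (hβ2 : 2 ≤ β ^ 2) (hβ : β ≤ 2)
    (hK : 7 ≤ K)
    (hload : ∀ u w, u ≠ w → edgeLoad K (2 / β ^ 2) G u w ≤ T)
    (hT : β * (2 / β ^ 2) ^ (K - 6) * (4 * T) ≤ 2 - β) :
    ∃ R : Finset (Sym2 V), ∀ u v, u ≠ v → ¬ G.Adj u v → K ≤ G.codegree u v →
      ∃ z ∈ freeCommon G P u v, ¬ (s(u, z) ∈ R ↔ s(v, z) ∈ R) := by
  set r : ℝ := 2 / β ^ 2 with hr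
  have hβ' : 0 < β := by linarith
  have hr0 : 0 < r := by positivity
  have hr1 : r ≤ 1 := by rw [hr, div_le_one (by positivity)]; exact hβ2
  let fat : V × V → Prop := fun i ↦ i.1 ≠ i.2 ∧ ¬ G.Adj i.1 i.2 ∧ K ≤ G.codegree i.1 i.2
  let D : V × V → Finset (Sym2 V) := fun i ↦ if fat i then freeEdges G P i.1 i.2 else ∅
  let Bad : V × V → Finset (Finset (Sym2 V)) := fun i ↦
    if fat i then monochromaticSets G P i.1 i.2 else ∅
  have hcard : ∀ i, fat i → G.codegree i.1 i.2 - 6 ≤ #(freeCommon G P i.1 i.2) := fun i _ ↦ by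
    have := codegree_le_card_freeCommon_add (G := G) hP i.1 i.2
    omega
  obtain ⟨R, hR⟩ : ∃ R : Finset (Sym2 V), ∀ i, R ∩ D i ∉ Bad i := by
    refine exists_forall_inter_notMem hβ' (fun i hi ↦ ?_) fun e ↦ ?_
    · by_cases hf : fat i
      · have h1 := hcard i hf
        have h2 := card_freeEdges (G := G) (P := P) hf.1
        have h3 := hf.2.2
        simp only [D, if_pos hf] at hi
        rw [hi, card_empty] at h2
        omega
      · simp [Bad, hf]
    · induction e using Sym2.ind with | _ a b => ?_
      have hmem : ∀ i, s(a, b) ∈ D i → fat i ∧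
          ((i.1 = a ∧ b ∈ freeCommon G P i.1 i.2) ∨ (i.1 = b ∧ a ∈ freeCommon G P i.1 i.2) ∨
          (i.2 = a ∧ b ∈ freeCommon G P i.1 i.2) ∨ (i.2 = b ∧ a ∈ freeCommon G P i.1 i.2)) := by
        intro i hi
        by_cases hf : fat i
        · simp only [D, if_pos hf, freeEdges, mem_union, mem_image] at hi
          refine ⟨hf, ?_⟩
          rcases hi with ⟨z, hz, he⟩ | ⟨z, hz, he⟩ <;>
            rcases Sym2.eq_iff.1 he with ⟨rfl, rfl⟩ | ⟨rfl, rfl⟩ <;> simp [hz]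
        · simp [D, hf] at hi
      by_cases hab : a = b
      · subst hab
        rw [sum_eq_zero, sub_nonneg]
        · exact hβ
        · intro i hi
          have := hmem i (mem_filter.1 hi).2
          simp only [freeCommon, mem_filter, mem_univ, true_and] at this
          obtain ⟨-, ⟨rfl, h⟩ | ⟨rfl, h⟩ | ⟨rfl, h⟩ | ⟨rfl, h⟩⟩ := this <;> simp at h
      let g : V → V → V → ℝ := fun u w v ↦
        if G.Adj v w ∧ ¬ G.Adj u v ∧ v ≠ u ∧ K ≤ G.codegree u v then
          r ^ (G.codegree u v - K) else 0
      have hg : ∀ u w v, 0 ≤ g u w v := fun u w v ↦ by simp only [g]; positivity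
      have hite : ∀ (q : Prop) (u w v), 0 ≤ if q then g u w v else 0 := fun q u w v ↦ by
        split_ifs <;> simp [hg]
      set C := β * r ^ (K - 6) with hC
      have hC0 : 0 ≤ C := by positivity
      -- `2 ^ f` bad patterns on `2 * f` edges, where `f` is at least the codegree minus six
      have hterm : ∀ i, fat i →
          (#(Bad i) : ℝ) / β ^ (#(D i) - 1) ≤ C * r ^ (G.codegree i.1 i.2 - K) := by
        intro i hf
        have h1 := hcard i hf
        have h2 := hf.2.2
        set f := #(freeCommon G P i.1 i.2)
        have h3 : #(Bad i) ≤ 2 ^ f := by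
          simp only [Bad, if_pos hf]
          exact card_monochromaticSets_le P i.1 i.2
        have h4 : #(D i) = 2 * f := by
          simp only [D, if_pos hf]
          exact card_freeEdges hf.1
        calc (#(Bad i) : ℝ) / β ^ (#(D i) - 1) ≤ 2 ^ f / β ^ (2 * f - 1) := by
              rw [h4]
              gcongr
              exact_mod_cast h3
          _ = β * r ^ f := by
              rw [hr, div_pow, ← pow_mul, pow_sub₀ _ hβ'.ne' (by omega), pow_one]
              field_simp
          _ ≤ β * r ^ (K - 6 + (G.codegree i.1 i.2 - K)) := by
              gcongr β * ?_
              exact pow_le_pow_of_le_one hr0.le hr1 (by omega)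
          _ = _ := by rw [hC, pow_add, mul_assoc]
      have hbound : ∀ i ∈ univ.filter (fun i ↦ s(a, b) ∈ D i),
          (#(Bad i) : ℝ) / β ^ (#(D i) - 1) ≤ C * ((if i.1 = a then g a b i.2 else 0) +
            (if i.1 = b then g b a i.2 else 0) + (if i.2 = a then g a b i.1 else 0) +
            (if i.2 = b then g b a i.1 else 0)) := by
        intro i hi
        obtain ⟨hf, hi⟩ := hmem i (mem_filter.1 hi).2
        refine (hterm i hf).trans (mul_le_mul_of_nonneg_left ?_ hC0)
        obtain ⟨u, v⟩ := i
        have n1 : 0 ≤ if u = a then g a b v else 0 := hite _ _ _ _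
        have n2 : 0 ≤ if u = b then g b a v else 0 := hite _ _ _ _
        have n3 : 0 ≤ if v = a then g a b u else 0 := hite _ _ _ _
        have n4 : 0 ≤ if v = b then g b a u else 0 := hite _ _ _ _
        have key1 : ∀ c ∈ freeCommon G P u v, g u c v = r ^ (G.codegree u v - K) := by
          intro c hc
          simp only [freeCommon, mem_filter, mem_univ, true_and] at hc
          simp only [g]
          exact if_pos ⟨hc.2.1, hf.2.1, hf.1.symm, hf.2.2⟩
        have key2 : ∀ c ∈ freeCommon G P u v, g v c u = r ^ (G.codegree u v - K) := by
          intro c hc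
          simp only [freeCommon, mem_filter, mem_univ, true_and] at hc
          simp only [g]
          rw [codegree_comm G v u]
          exact if_pos ⟨hc.1, fun h ↦ hf.2.1 h.symm, hf.1, hf.2.2⟩
        simp only at hi ⊢
        rcases hi with ⟨rfl, h⟩ | ⟨rfl, h⟩ | ⟨rfl, h⟩ | ⟨rfl, h⟩
        · rw [if_pos rfl, key1 _ h] at *; linarith
        · rw [← key1 _ h, if_pos (c := u = u) rfl] at *; linarith
        · rw [← key2 _ h, if_pos (c := v = v) rfl] at *; linarith
        · rw [← key2 _ h, if_pos (c := v = v) rfl] at *; linarith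
      calc _ ≤ ∑ i : V × V, C * ((if i.1 = a then g a b i.2 else 0) +
            (if i.1 = b then g b a i.2 else 0) + (if i.2 = a then g a b i.1 else 0) +
            (if i.2 = b then g b a i.1 else 0)) := by
            refine (sum_le_sum hbound).trans
              (sum_le_sum_of_subset_of_nonneg (filter_subset _ _) fun i _ _ ↦ ?_)
            exact mul_nonneg hC0 (add_nonneg (add_nonneg (add_nonneg (hite _ _ _ _) (hite _ _ _ _))
              (hite _ _ _ _)) (hite _ _ _ _))
        _ = C * (2 * (edgeLoad K r G a b + edgeLoad K r G b a)) := by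
            rw [← mul_sum, Fintype.sum_prod_type]
            simp only [sum_add_distrib, sum_ite_eq', mem_univ, if_true]
            rw [sum_comm (f := fun x y ↦ if x = a then g a b y else 0),
              sum_comm (f := fun x y ↦ if x = b then g b a y else 0)]
            simp only [sum_ite_eq', mem_univ, if_true, edgeLoad, g]
            ring
        _ ≤ C * (4 * T) := by
            have h1 := hload a b hab
            have h2 := hload b a (Ne.symm hab)
            exact mul_le_mul_of_nonneg_left (by linarith) hC0
        _ ≤ 2 - β := hT
  refine ⟨R, fun u v huv hadj hk ↦ ?_⟩
  have hf : fat (u, v) := ⟨huv, hadj, hk⟩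
  by_contra! hcon
  refine hR (u, v) ?_
  simp only [D, Bad, if_pos hf, monochromaticSets, mem_filter, mem_powerset]
  refine ⟨inter_subset_right, fun z hz ↦ ?_⟩
  have h1 : s(u, z) ∈ freeEdges G P u v := mem_union_left _ (mem_image_of_mem _ hz)
  have h2 : s(v, z) ∈ freeEdges G P u v :=
    mem_union_right _ (mem_image_of_mem (fun z ↦ s(v, z)) hz)
  simp [h1, h2, hcon z hz]

/-- A graph of diameter at most two whose thin pairs are scattered and whose edge loads are small
has a rainbow two-colouring. Each thin pair gets a path through a centre of its own, and the
colouring of the remaining edges serves the other pairs. -/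
theorem rainbowConnectionNumber_le_two [LinearOrder V]
    (hdiam : ∀ u v, u ≠ v → ¬ G.Adj u v → ∃ w, G.Adj u w ∧ G.Adj v w)
    (hthin : G.ThinPairsScattered K) {β T : ℝ} (hβ0 : 1 ≤ β) (hβ2 : 2 ≤ β ^ 2) (hβ : β ≤ 2)
    (hK : 7 ≤ K)
    (hload : ∀ u w, u ≠ w → edgeLoad K (2 / β ^ 2) G u w ≤ T)
    (hT : β * (2 / β ^ 2) ^ (K - 6) * (4 * T) ≤ 2 - β) :
    G.rainbowConnectionNumber ≤ 2 := by
  obtain ⟨m, hmsymm, hm⟩ : ∃ m : V → V → V, (∀ u v, m u v = m v u) ∧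
      ∀ u v, G.IsThin K u v → G.Adj u (m u v) ∧ G.Adj v (m u v) := by
    have : ∀ u v, ∃ w, G.IsThin K u v → G.Adj u w ∧ G.Adj v w := fun u v ↦ by
      by_cases h : G.IsThin K u v
      · obtain ⟨w, hw⟩ := hdiam u v h.1 h.2.1
        exact ⟨w, fun _ ↦ hw⟩
      · exact ⟨u, fun h' ↦ absurd h' h⟩
    choose f hf using this
    refine ⟨fun u v ↦ f (min u v) (max u v), fun u v ↦ by simp only [min_comm v u, max_comm v u],
      fun u v h ↦ ?_⟩
    rcases le_total u v with huv | huv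
    · simpa [huv] using hf u v h
    · simpa [huv, and_comm] using hf v u h.symm
  set P := reservedEdges G K m with hPdef
  obtain ⟨R, hR⟩ := exists_bicoloured_of_edgeLoad_le (hthin.card_reserved_le hm) hβ0 hβ2 hβ hK
    hload hT
  -- the path through the centre of a thin pair starts with colour `0` at its smaller member
  let c : Sym2 V → Fin 2 := fun e ↦
    if e ∈ P then (if ∃ u v, G.IsThin K u v ∧ u < v ∧ e = s(u, m u v) then 0 else 1)
    else if e ∈ R then 0 else 1
  have hthinc : ∀ u v, G.IsThin K u v → u < v → c s(u, m u v) = 0 ∧ c s(v, m u v) = 1 := by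
    intro u v h huv
    have h2 : s(v, m u v) ∈ P := ⟨v, u, h.symm, by rw [hmsymm]⟩
    refine ⟨by simp only [c]; rw [if_pos ⟨u, v, h, rfl⟩, if_pos ⟨u, v, h, huv, rfl⟩], ?_⟩
    simp only [c]
    rw [if_pos h2, if_neg]
    rintro ⟨x, y, hxy, hlt, he⟩
    rw [hmsymm u v] at he
    obtain ⟨rfl, rfl⟩ := hthin.eq_of_reserved hm h.symm hxy he
    exact lt_asymm huv hlt
  refine (isRainbow_restrictLabeling (c := c) fun u v huv ↦ .inl ?_).rainbowConnectionNumber_le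
  by_cases hadj : G.Adj u v
  · exact .inl hadj
  · right
    by_cases hk : K ≤ G.codegree u v
    · obtain ⟨z, hz, hne⟩ := hR u v huv hadj hk
      simp only [freeCommon, mem_filter, mem_univ, true_and] at hz
      refine ⟨z, hz.1, hz.2.1.symm, ?_⟩
      rw [Sym2.eq_swap (a := z)]
      simp only [c]
      by_cases h1 : s(u, z) ∈ R <;> by_cases h2 : s(v, z) ∈ R <;> simp_all
    · have hth : G.IsThin K u v := ⟨huv, hadj, not_le.1 hk⟩
      refine ⟨m u v, (hm u v hth).1, (hm u v hth).2.symm, ?_⟩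
      rw [Sym2.eq_swap (a := m u v)]
      rcases lt_or_gt_of_ne huv with hlt | hlt
      · rw [(hthinc u v hth hlt).1, (hthinc u v hth hlt).2]
        decide
      · have := hthinc v u hth.symm hlt
        rw [hmsymm v u] at this
        rw [this.1, this.2]
        decide

end TwoColours

/-! ### Edge probabilities near the threshold for diameter two -/

section Window

open Classical unitInterval

/-- The range of edge probabilities considered: `n p ^ 2` is at least `39 / 20 * log n`, and `p` is
at most `n ^ (-9 / 20)`. -/
structure DensityWindow (n : ℕ) (p : I) : Prop where
  log_ge : 20 ≤ Real.log n
  lower : 39 / 20 * Real.log n ≤ n * (p : ℝ) ^ 2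
  upper : (p : ℝ) ≤ Real.exp (-(9 / 20 * Real.log n))

namespace DensityWindow

variable {n : ℕ} {p : I} (h : DensityWindow n p)

include h

lemma cast_eq_exp : (n : ℝ) = Real.exp (Real.log n) := by
  rw [Real.exp_log]
  rcases Nat.eq_zero_or_pos n with rfl | hn
  · have := h.log_ge
    norm_num at this
  · exact_mod_cast hn

lemma cast_ge : (1000 : ℝ) ≤ n := by
  rw [h.cast_eq_exp]
  calc (1000 : ℝ) ≤ 2.7 ^ 20 := by norm_num
    _ ≤ Real.exp 1 ^ 20 := by gcongr; linarith [Real.exp_one_gt_d9]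
    _ = Real.exp 20 := by rw [← Real.exp_nat_mul]; norm_num
    _ ≤ _ := Real.exp_le_exp.2 h.log_ge

/-- The expected degree far exceeds `log n`; the constant only has to beat the union bounds. -/
lemma mul_ge : 1000 * Real.log n ≤ n * p := by
  have hL := h.log_ge
  have hlo := h.lower
  have hup := h.upper
  have hp0 : (0 : ℝ) ≤ p := p.2.1
  have he : (1000 : ℝ) ≤ Real.exp (9 / 20 * Real.log n) := by
    calc (1000 : ℝ) ≤ 2.7 ^ 9 := by norm_num
      _ ≤ Real.exp 1 ^ 9 := by gcongr; linarith [Real.exp_one_gt_d9]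
      _ = Real.exp 9 := by rw [← Real.exp_nat_mul]; norm_num
      _ ≤ _ := Real.exp_le_exp.2 (by linarith)
  rw [Real.exp_neg] at hup
  set x := Real.exp (9 / 20 * Real.log n)
  have hx : (p : ℝ) * x ≤ 1 := by
    calc (p : ℝ) * x ≤ x⁻¹ * x := by gcongr
      _ = 1 := inv_mul_cancel₀ (by positivity)
  have hn : (0 : ℝ) ≤ n := Nat.cast_nonneg n
  calc 1000 * Real.log n ≤ x * (39 / 20 * Real.log n) := by nlinarith
    _ ≤ x * (n * (p : ℝ) ^ 2) := by gcongr
    _ = n * p * (p * x) := by ring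
    _ ≤ n * p * 1 := by gcongr
    _ = n * p := mul_one _

lemma mul_cube_le : (n : ℝ) * p ^ 3 ≤ 1 := by
  have hp0 : (0 : ℝ) ≤ p := p.2.1
  have hL := h.log_ge
  calc (n : ℝ) * p ^ 3 ≤ Real.exp (Real.log n) * Real.exp (-(9 / 20 * Real.log n)) ^ 3 := by
        rw [← h.cast_eq_exp]
        have := h.upper
        gcongr
    _ = Real.exp (Real.log n + 3 * -(9 / 20 * Real.log n)) := by
        rw [← Real.exp_nat_mul, ← Real.exp_add]
        norm_num
    _ ≤ 1 := Real.exp_le_one_iff.2 (by linarith)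

lemma pow_mul_exp_le {k : ℕ} {c d : ℝ} (hcd : k + c ≤ d) :
    (n : ℝ) ^ k * Real.exp (c * Real.log n) ≤ Real.exp (d * Real.log n) := by
  have hL := h.log_ge
  rw [h.cast_eq_exp, ← Real.exp_nat_mul, Real.log_exp, ← Real.exp_add, ← add_mul]
  exact Real.exp_le_exp.2 (mul_le_mul_of_nonneg_right hcd (by linarith))

end DensityWindow

lemma one_sub_pow_le_exp {x : ℝ} (hx : x ≤ 1) (k : ℕ) : (1 - x) ^ k ≤ Real.exp (-(k * x)) := by
  calc (1 - x) ^ k ≤ Real.exp (-x) ^ k := by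
        have := Real.add_one_le_exp (-x)
        gcongr
        linarith
    _ = _ := by rw [← Real.exp_nat_mul, mul_neg]

/-- The union bound. -/
lemma measureReal_exists_le {V ι : Type*} [Fintype V] [Fintype ι] (p : I)
    {E : ι → SimpleGraph V → Prop} {B : ℝ}
    (hE : ∀ i, (binomialRandom V p).real {G | E i G} ≤ B) :
    (binomialRandom V p).real {G | ∃ i, E i G} ≤ Fintype.card ι * B := by
  have : {G | ∃ i, E i G} = ⋃ i, {G | E i G} := by ext; simp
  rw [this]
  refine (measureReal_iUnion_fintype_le _).trans ((Finset.sum_le_sum fun i _ ↦ hE i).trans ?_)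
  simp

/-! ### The random graph has a rainbow three-colouring -/

lemma le_card_residueClass {n a : ℕ} (ha : a < 3) (u v : Fin n) :
    n ≤ 3 * (residueClass a u v).card + 8 := by
  have h1 : n / 3 ≤ ((Finset.univ : Finset (Fin n)).filter fun x ↦ x.val % 3 = a).card := by
    rw [← Finset.card_range (n / 3)]
    refine Finset.card_le_card_of_injOn
      (fun i ↦ if h : 3 * i + a < n then ⟨3 * i + a, h⟩ else u) (fun i hi ↦ ?_)
      fun i hi j hj hij ↦ ?_
    · have : 3 * i + a < n := by simp at hi; omega
      simp only [this, dif_pos, Finset.coe_filter, Finset.mem_univ, true_and, Set.mem_ofPred_eq]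
      omega
    · have h1 : 3 * i + a < n := by simp at hi; omega
      have h2 : 3 * j + a < n := by simp at hj; omega
      simp only [h1, h2, dif_pos, Fin.mk.injEq] at hij
      omega
  have h2 : ((Finset.univ : Finset (Fin n)).filter fun x ↦ x.val % 3 = a).card ≤
      (residueClass a u v ∪ {u, v}).card := Finset.card_le_card fun x hx ↦ by
    simp only [residueClass, Finset.mem_union, Finset.mem_filter, Finset.mem_univ, true_and,
      Finset.mem_insert, Finset.mem_singleton] at hx ⊢
    tauto
  have h3 := Finset.card_union_le (residueClass a u v) {u, v}
  have h4 : ({u, v} : Finset (Fin n)).card ≤ 2 := Finset.card_le_two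
  omega

lemma log_two_lt : Real.log 2 < 0.6932 := by linarith [Real.log_two_lt_d9]

lemma measureReal_no_residue_path_le {n : ℕ} {p : I} (h : DensityWindow n p) {u v : Fin n}
    (huv : u ≠ v) {a b : ℕ} (ha : a < 3) (hb : b < 3) (hab : a ≠ b) :
    (binomialRandom (Fin n) p).real {G | ¬ ∃ x ∈ residueClass a u v, ∃ y ∈ residueClass b u v,
      G.Adj u x ∧ G.Adj x y ∧ G.Adj y v} ≤ 2 * Real.exp (-3 * Real.log n) := by
  set X := residueClass a u v
  set Y := residueClass b u v
  have hp0 : (0 : ℝ) ≤ p := p.2.1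
  have hp1 : (p : ℝ) ≤ 1 := p.2.2
  have hn := h.cast_ge
  have hnp := h.mul_ge
  have hlo := h.lower
  have hL := h.log_ge
  have hcard : ∀ c < 3, (n : ℝ) / 4 ≤ (residueClass c u v).card := fun c hc ↦ by
    have : (n : ℝ) ≤ 3 * (residueClass c u v).card + 8 := by
      exact_mod_cast le_card_residueClass hc u v
    linarith
  have hu : ∀ c, u ∉ residueClass c u v := fun c ↦ by simp [residueClass]
  have hv : ∀ c, v ∉ residueClass c u v := fun c ↦ by simp [residueClass]
  have hXY : Disjoint X Y := Finset.disjoint_left.2 fun x hx hy ↦ by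
    simp only [X, Y, residueClass, Finset.mem_filter] at hx hy
    omega
  set m := ⌊(n * p : ℝ) / 8⌋₊ with hm
  have hm1 : (m : ℝ) ≤ n * p / 8 := Nat.floor_le (by positivity)
  have hm2 : (n : ℝ) * p / 8 - 1 < (m : ℝ) := by linarith [Nat.lt_floor_add_one ((n * p : ℝ) / 8)]
  have hpart1 : (binomialRandom (Fin n) p).real
      {G | ((X.filter (G.Adj u)).card : ℝ) ≤ n * p / 8} ≤ Real.exp (-3 * Real.log n) := by
    refine (measureReal_card_filter_adj_le p (hu a) _).trans (Real.exp_le_exp.2 ?_)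
    have h1 := mul_le_mul_of_nonneg_left (hcard a ha) hp0
    have h2 := mul_le_mul_of_nonneg_left log_two_lt.le (show 0 ≤ (n : ℝ) * p / 8 by positivity)
    nlinarith
  have hpart2 : (binomialRandom (Fin n) p).real {G | (m : ℝ) ≤ (X.filter (G.Adj u)).card ∧
      ∀ x ∈ X, ∀ y ∈ Y, G.Adj u x → G.Adj x y → ¬ G.Adj y v} ≤ Real.exp (-3 * Real.log n) := by
    refine (measureReal_no_path_le p (hu a) (hu b) (hv a) (hv b) huv hXY).trans ?_
    have hhalf : (1 - p : ℝ) ^ m ≤ 1 / 2 := by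
      refine (one_sub_pow_le_exp hp1 m).trans ?_
      have h1 : 1 ≤ (m : ℝ) * p := by nlinarith
      calc Real.exp (-(m * p)) ≤ Real.exp (-1) := Real.exp_le_exp.2 (by linarith)
        _ ≤ 1 / 2 := by
          rw [Real.exp_neg, one_div]
          gcongr
          linarith [Real.exp_one_gt_d9]
    have hge : 0 ≤ (1 - p : ℝ) ^ m := pow_nonneg (by linarith) m
    refine (one_sub_pow_le_exp (by nlinarith) _).trans (Real.exp_le_exp.2 ?_)
    have h1 : (p : ℝ) / 2 ≤ p * (1 - (1 - p : ℝ) ^ m) := by nlinarith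
    have h2 : (n : ℝ) / 4 * (p / 2) ≤ Y.card * (p * (1 - (1 - p : ℝ) ^ m)) := by
      have := hcard b hb
      gcongr
    nlinarith
  calc _ ≤ (binomialRandom (Fin n) p).real
        ({G | ((X.filter (G.Adj u)).card : ℝ) ≤ n * p / 8} ∪
          {G | (m : ℝ) ≤ (X.filter (G.Adj u)).card ∧
            ∀ x ∈ X, ∀ y ∈ Y, G.Adj u x → G.Adj x y → ¬ G.Adj y v}) := by
        refine measureReal_mono fun G hG ↦ ?_
        by_cases hc : ((X.filter (G.Adj u)).card : ℝ) ≤ n * p / 8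
        · exact .inl hc
        · exact .inr ⟨by linarith, fun x hx y hy h1 h2 h3 ↦ hG ⟨x, hx, y, hy, h1, h2, h3⟩⟩
    _ ≤ _ := (measureReal_union_le _ _).trans (by linarith)

/-! ### Edge loads -/

/-- Here `2 / (39 / 20) ^ 2` is the weight `2 / β ^ 2` of the counting criterion with `β = 39 / 20`,
and the threshold `21` makes `r ^ (21 - 6)` small enough for loads up to `60`. -/
lemma measureReal_edgeLoad_gt_le {n : ℕ} {p : I} (h : DensityWindow n p) {u w : Fin n}
    (huw : u ≠ w) :
    (binomialRandom (Fin n) p).real {G | 60 < edgeLoad 21 (2 / (39 / 20) ^ 2) G u w} ≤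
      (1 + Real.exp (2 ^ 23)) * Real.exp (-3 * Real.log n) := by
  set r : ℝ := 2 / (39 / 20) ^ 2 with hr
  have hp0 : (0 : ℝ) ≤ p := p.2.1
  have hp1 : (p : ℝ) ≤ 1 := p.2.2
  have hn := h.cast_ge
  have hnp := h.mul_ge
  have hlo := h.lower
  have hL := h.log_ge
  set X : Finset (Fin n) := Finset.univ \ {u, w} with hX
  have hXcard : (X.card : ℝ) = n - 2 := by
    rw [hX, ← Finset.compl_eq_univ_sdiff, Finset.card_compl, Finset.card_pair huw,
      Fintype.card_fin, Nat.cast_sub]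
    · simp
    · exact_mod_cast (show (2 : ℝ) ≤ n by linarith)
  -- `7 / 10 * log 2 < 1 / 2` makes a smaller degree unlikely, and `2 * (7 / 10) * (1 - r) > 1 / 2`
  -- leaves the expected load polynomially small
  set m := ⌊(7 / 10 * (n * p) : ℝ)⌋₊ with hm
  have hm1 : (m : ℝ) ≤ 7 / 10 * (n * p) := Nat.floor_le (by positivity)
  have hm2 : 7 / 10 * ((n : ℝ) * p) - 1 < (m : ℝ) := by
    linarith [Nat.lt_floor_add_one (7 / 10 * (n * p) : ℝ)]
  have hpart1 : (binomialRandom (Fin n) p).real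
      {G | ((X.filter (G.Adj u)).card : ℝ) ≤ 7 / 10 * (n * p)} ≤ Real.exp (-3 * Real.log n) := by
    refine (measureReal_card_filter_adj_le p (by simp [X]) _).trans (Real.exp_le_exp.2 ?_)
    rw [hXcard]
    have h2 := mul_le_mul_of_nonneg_left log_two_lt.le
      (show 0 ≤ 7 / 10 * (n * p : ℝ) by positivity)
    nlinarith
  have hpart2 : (binomialRandom (Fin n) p).real {G | (m : ℝ) ≤ (X.filter (G.Adj u)).card ∧
      60 ≤ edgeLoad 21 r G u w} ≤ Real.exp (2 ^ 23) * Real.exp (-3 * Real.log n) := by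
    -- the exponential moment is taken at `n ^ (1 / 20)`
    refine (measureReal_edgeLoad_ge_le p huw (X := X) (by simp [X]) 21 (r := r)
      (by norm_num [hr]) (by norm_num [hr])
      (l := 1 / 20 * Real.log n) (T := 60) (by positivity)).trans ?_
    rw [← Real.exp_add, Fintype.card_fin]
    refine Real.exp_le_exp.2 ?_
    have hpow : (1 - p * (1 - r) : ℝ) ^ m ≤ Real.exp (1 - 647 / 1000 * Real.log n) := by
      have hr1 : r ≤ 1 := by norm_num [hr]
      have hr2 : 0 ≤ r := by norm_num [hr]
      refine (one_sub_pow_le_exp (by nlinarith) m).trans (Real.exp_le_exp.2 ?_)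
      have h1 : (7 / 10 * ((n : ℝ) * p) - 1) * p ≤ (m : ℝ) * p := by gcongr
      have h2 : (7 / 10 * (39 / 20 * Real.log n) - 1 : ℝ) ≤ m * p := by nlinarith
      have h3 : (474 / 1000 : ℝ) ≤ 1 - r := by norm_num [hr]
      have h4 : (7 / 10 * (39 / 20 * Real.log n) - 1 : ℝ) * (474 / 1000) ≤ m * p * (1 - r) := by
        gcongr
      nlinarith
    have hrK : (r ^ 21)⁻¹ ≤ 2 ^ 21 := by norm_num [hr]
    have hmain : (n : ℝ) * (Real.exp (1 / 20 * Real.log n) / r ^ 21 * p *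
        (1 - p * (1 - r)) ^ m) ≤ 2 ^ 23 := by
      have hr1 : r ≤ 1 := by norm_num [hr]
      have hr2 : 0 < r := by norm_num [hr]
      have hq : 0 ≤ 1 - p * (1 - r) := by nlinarith
      calc _ = n * Real.exp (1 / 20 * Real.log n) * (r ^ 21)⁻¹ * p * (1 - p * (1 - r)) ^ m := by
            ring
        _ ≤ Real.exp (Real.log n) * Real.exp (1 / 20 * Real.log n) * 2 ^ 21 *
            Real.exp (-(9 / 20 * Real.log n)) * Real.exp (1 - 647 / 1000 * Real.log n) := by
            rw [← h.cast_eq_exp]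
            have := h.upper
            gcongr
        _ = 2 ^ 21 * Real.exp (1 - 47 / 1000 * Real.log n) := by
            rw [← Real.exp_add, mul_comm _ (2 ^ 21 : ℝ), mul_assoc, mul_assoc, ← Real.exp_add,
              ← Real.exp_add]
            congr 2
            ring
        _ ≤ 2 ^ 21 * Real.exp 1 := by
            gcongr
            linarith
        _ ≤ 2 ^ 23 := by linarith [Real.exp_one_lt_d9]
    linarith
  calc _ ≤ (binomialRandom (Fin n) p).real
        ({G | ((X.filter (G.Adj u)).card : ℝ) ≤ 7 / 10 * (n * p)} ∪
          {G | (m : ℝ) ≤ (X.filter (G.Adj u)).card ∧ 60 ≤ edgeLoad 21 r G u w}) := by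
        refine measureReal_mono fun G hG ↦ ?_
        by_cases hc : ((X.filter (G.Adj u)).card : ℝ) ≤ 7 / 10 * (n * p)
        · exact .inl hc
        · exact .inr ⟨by linarith, le_of_lt hG⟩
    _ ≤ _ := (measureReal_union_le _ _).trans (by
        rw [add_mul, one_mul]
        exact add_le_add hpart1 hpart2)

/-! ### Thin pairs -/

/-- The loss in Markov's inequality when the codegrees are discounted with `s = 1 / 32`, a value for
which `4 * (1 - s)` is close enough to `4` for all the union bounds. -/
lemma inv_pow_thirtyTwo_le : (((1 / 32 : ℝ)) ^ (2 * 21))⁻¹ ≤ 2 ^ 210 := by norm_num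

lemma measureReal_thin_meet_le {n : ℕ} {p : I} (h : DensityWindow n p) (u v w : Fin n) :
    (binomialRandom (Fin n) p).real
      {G | v ≠ w ∧ G.IsThin 21 u v ∧ G.IsThin 21 u w} ≤
      2 ^ 210 * Real.exp 7 * Real.exp (-(37 / 10) * Real.log n) := by
  by_cases hd : u ≠ v ∧ u ≠ w ∧ v ≠ w
  swap
  · convert (show (0 : ℝ) ≤ 2 ^ 210 * Real.exp 7 * Real.exp (-(37 / 10) * Real.log n) by positivity)
    rw [measureReal_eq_zero_iff]
    convert measure_empty (μ := binomialRandom (Fin n) p)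
    ext G
    simp only [IsThin, Set.mem_ofPred_eq, Set.mem_empty_iff_false, iff_false]
    tauto
  obtain ⟨huv, huw, hvw⟩ := hd
  have hp0 : (0 : ℝ) ≤ p := p.2.1
  have hp1 : (p : ℝ) ≤ 1 := p.2.2
  have hlo := h.lower
  have hL := h.log_ge
  have hn := h.cast_ge
  have hcube := h.mul_cube_le
  refine (measureReal_mono ?_).trans
    ((measureReal_two_meeting_codegree_lt_le p huv huw hvw 21 (s := 1 / 32)
    (by norm_num) (by norm_num)).trans ?_)
  · exact fun G hG ↦ ⟨hG.2.1.2.2, hG.2.2.2.2⟩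
  have hcard : (n : ℝ) - 3 ≤ ((Finset.univ : Finset (Fin n)) \ {u, v, w}).card := by
    have h1 := Finset.le_card_sdiff {u, v, w} (Finset.univ : Finset (Fin n))
    have h2 : ({u, v, w} : Finset (Fin n)).card ≤ 3 := Finset.card_le_three
    rw [Finset.card_fin] at h1
    have h3 : n ≤ ((Finset.univ : Finset (Fin n)) \ {u, v, w}).card + 3 := by omega
    have h4 : (n : ℝ) ≤ ((Finset.univ : Finset (Fin n)) \ {u, v, w}).card + 3 := by
      exact_mod_cast h3
    linarith
  set N := ((Finset.univ : Finset (Fin n)) \ {u, v, w}).card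
  rw [mul_assoc, ← Real.exp_add]
  refine mul_le_mul inv_pow_thirtyTwo_le ?_ (pow_nonneg ?_ _) (by positivity)
  · rw [show (1 + p * ((1 - p * (1 - 1 / 32)) ^ 2 - 1) : ℝ) =
      1 - (31 / 16 * p ^ 2 - (31 / 32) ^ 2 * p ^ 3) by ring]
    refine (one_sub_pow_le_exp (by nlinarith) _).trans (Real.exp_le_exp.2 ?_)
    have h2 : (p : ℝ) ^ 2 ≤ 1 := pow_le_one₀ hp0 hp1
    have h3 : (p : ℝ) ^ 3 ≤ p ^ 2 := pow_le_pow_of_le_one hp0 hp1 (by norm_num)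
    have h4 : (n - 3 : ℝ) * (31 / 16 * p ^ 2 - (31 / 32) ^ 2 * p ^ 3) ≤
        N * (31 / 16 * p ^ 2 - (31 / 32) ^ 2 * p ^ 3) := by
      gcongr
      nlinarith [sq_nonneg (p : ℝ)]
    nlinarith [pow_nonneg hp0 3]
  · have h5 : 0 ≤ (1 - p * (1 - 1 / 32) : ℝ) ^ 2 := sq_nonneg _
    nlinarith

lemma measureReal_two_thin_le {n : ℕ} {p : I} (h : DensityWindow n p) {u v x y : Fin n}
    (huv : u ≠ v) (hxy : x ≠ y) (hux : u ≠ x) (huy : u ≠ y) (hvx : v ≠ x) (hvy : v ≠ y)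
    {Z : Finset (Fin n)} (hZ : Disjoint Z {u, v, x, y}) (hZc : n ≤ Z.card + 5)
    {D : SimpleGraph (Fin n) → Prop}
    {S : Set (Sym2 (Fin n))} (hD : DependsOnEdges D S)
    (hSZ : ∀ z ∈ Z, Disjoint S (starPairs z {u, v, x, y})) :
    (binomialRandom (Fin n) p).real
      {G | D G ∧ G.codegree u v < 21 ∧ G.codegree x y < 21} ≤
      (binomialRandom (Fin n) p).real {G | D G} *
        (2 ^ 210 * Real.exp 10 * Real.exp (-(377 / 100) * Real.log n)) := by
  have hp0 : (0 : ℝ) ≤ p := p.2.1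
  have hp1 : (p : ℝ) ≤ 1 := p.2.2
  have hlo := h.lower
  have hL := h.log_ge
  refine (measureReal_two_disjoint_codegree_lt_le p huv hxy hux huy hvx hvy 21 (s := 1 / 32)
    (by norm_num) (by norm_num) hZ hD hSZ).trans ?_
  refine mul_le_mul_of_nonneg_left ?_ measureReal_nonneg
  rw [mul_assoc, ← Real.exp_add, ← pow_mul]
  have h2 : (p : ℝ) ^ 2 ≤ 1 := pow_le_one₀ hp0 hp1
  refine mul_le_mul inv_pow_thirtyTwo_le ?_ (pow_nonneg (by nlinarith) _) (by positivity)
  refine (one_sub_pow_le_exp (by nlinarith) _).trans (Real.exp_le_exp.2 ?_)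
  have h3 : (n : ℝ) - 5 ≤ Z.card := by
    have : (n : ℝ) ≤ Z.card + 5 := by exact_mod_cast hZc
    linarith
  have h4 := mul_le_mul_of_nonneg_right h3 (sq_nonneg (p : ℝ))
  push_cast
  nlinarith

lemma measureReal_thin_adj_le {n : ℕ} {p : I} (h : DensityWindow n p) (u v x y : Fin n) :
    (binomialRandom (Fin n) p).real {G | G.IsThin 21 u v ∧ G.IsThin 21 x y ∧
      (u ≠ x ∧ u ≠ y ∧ v ≠ x ∧ v ≠ y) ∧ G.Adj u x} ≤
      2 ^ 210 * Real.exp 10 * Real.exp (-(421 / 100) * Real.log n) := by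
  by_cases hd : u ≠ v ∧ x ≠ y ∧ u ≠ x ∧ u ≠ y ∧ v ≠ x ∧ v ≠ y
  swap
  · convert (show (0 : ℝ) ≤ 2 ^ 210 * Real.exp 10 * Real.exp (-(421 / 100) * Real.log n) by
      positivity)
    rw [measureReal_eq_zero_iff]
    convert measure_empty (μ := binomialRandom (Fin n) p)
    ext G
    simp only [IsThin, Set.mem_ofPred_eq, Set.mem_empty_iff_false, iff_false]
    tauto
  obtain ⟨huv, hxy, hux, huy, hvx, hvy⟩ := hd
  have hL := h.log_ge
  refine (measureReal_mono ?_).trans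
    ((measureReal_two_thin_le h huv hxy hux huy hvx hvy (Z := Finset.univ \ {u, v, x, y})
      (D := fun G ↦ G.Adj u x) (S := starPairs u {x}) Finset.sdiff_disjoint ?_ ?_ ?_).trans ?_)
  · exact fun G hG ↦ ⟨hG.2.2.2, hG.1.2.2, hG.2.1.2.2⟩
  · have h1 := Finset.le_card_sdiff {u, v, x, y} (Finset.univ : Finset (Fin n))
    have h2 : ({u, v, x, y} : Finset (Fin n)).card ≤ 4 := Finset.card_le_four
    rw [Finset.card_fin] at h1
    omega
  · exact dependsOnEdges_starPairs fun G H hGH ↦ by simp [hGH x]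
  · intro z hz
    simp only [Finset.mem_sdiff, Finset.mem_univ, Finset.mem_insert, Finset.mem_singleton,
      true_and, not_or] at hz
    exact disjoint_starPairs (Ne.symm hz.1) (.inr (by simp [hz.2.2.1]))
  · rw [measureReal_adj p hux]
    calc _ ≤ Real.exp (-(9 / 20 * Real.log n)) *
          (2 ^ 210 * Real.exp 10 * Real.exp (-(377 / 100) * Real.log n)) := by
          have := h.upper
          gcongr
      _ = 2 ^ 210 * Real.exp 10 *
            Real.exp (-(9 / 20 * Real.log n) + -(377 / 100) * Real.log n) := by
          rw [Real.exp_add]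
          ring
      _ ≤ _ := by
          gcongr
          linarith

lemma measureReal_forall_adj_le {V : Type*} [Fintype V] (p : I) {w : V} {A : Finset V}
    (hw : w ∉ A) : (binomialRandom V p).real {G | ∀ a ∈ A, G.Adj w a} ≤ (p : ℝ) ^ A.card := by
  calc _ ≤ ∫ G : SimpleGraph V, ∏ a ∈ A, (if G.Adj w a then (1 : ℝ) else 0)
        ∂binomialRandom V p := by
        refine measureReal_le_integral p (fun G ↦ Finset.prod_nonneg fun a _ ↦ by positivity)
          fun G hG ↦ (Finset.prod_eq_one fun a ha ↦ if_pos (hG a ha)).ge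
    _ = _ := by
        rw [integral_prod_of_dependsOnEdges p (S := fun a ↦ starPairs w {a})
          (f := fun a (G : SimpleGraph V) ↦ if G.Adj w a then (1 : ℝ) else 0)]
        · refine Finset.prod_eq_pow_card fun a ha ↦ ?_
          rw [integral_adj_ite p (by grind)]
          ring
        · exact fun a _ ↦ dependsOnEdges_starPairs fun G H h ↦ by simp [h a]
        · exact fun a _ b _ hab ↦ disjoint_starPairs_of_disjoint (by simpa)

lemma measureReal_thin_common_le {n : ℕ} {p : I} (h : DensityWindow n p) (w u v x y : Fin n) :
    (binomialRandom (Fin n) p).real {G | G.IsThin 21 u v ∧ G.IsThin 21 x y ∧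
      (u ≠ x ∧ u ≠ y ∧ v ≠ x ∧ v ≠ y) ∧ (G.Adj w u ∧ G.Adj w v ∧ G.Adj w x ∧ G.Adj w y)} ≤
      2 ^ 210 * Real.exp 10 * Real.exp (-(555 / 100) * Real.log n) := by
  by_cases hd : (u ≠ v ∧ x ≠ y ∧ u ≠ x ∧ u ≠ y ∧ v ≠ x ∧ v ≠ y) ∧
    (w ≠ u ∧ w ≠ v ∧ w ≠ x ∧ w ≠ y)
  swap
  · convert (show (0 : ℝ) ≤ 2 ^ 210 * Real.exp 10 * Real.exp (-(555 / 100) * Real.log n) by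
      positivity)
    rw [measureReal_eq_zero_iff]
    convert measure_empty (μ := binomialRandom (Fin n) p)
    ext G
    simp only [IsThin, Set.mem_ofPred_eq, Set.mem_empty_iff_false, iff_false]
    rintro ⟨h1, h2, h3, h4⟩
    exact hd ⟨⟨h1.1, h2.1, h3⟩, h4.1.ne, h4.2.1.ne, h4.2.2.1.ne, h4.2.2.2.ne⟩
  obtain ⟨⟨huv, hxy, hux, huy, hvx, hvy⟩, hwu, hwv, hwx, hwy⟩ := hd
  have hL := h.log_ge
  have hp0 : (0 : ℝ) ≤ p := p.2.1
  have hw : w ∉ ({u, v, x, y} : Finset (Fin n)) := by simp [*]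
  refine (measureReal_mono ?_).trans
    ((measureReal_two_thin_le h huv hxy hux huy hvx hvy
      (Z := (Finset.univ \ {u, v, x, y}).erase w)
      (D := fun G ↦ ∀ a ∈ ({u, v, x, y} : Finset (Fin n)), G.Adj w a)
      (S := starPairs w {u, v, x, y}) ?_ ?_ ?_ ?_).trans ?_)
  · exact fun G hG ↦ ⟨by simpa using hG.2.2.2, hG.1.2.2, hG.2.1.2.2⟩
  · exact Finset.sdiff_disjoint.mono_left (Finset.erase_subset _ _)
  · have h1 := Finset.le_card_sdiff {u, v, x, y} (Finset.univ : Finset (Fin n))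
    have h2 : ({u, v, x, y} : Finset (Fin n)).card ≤ 4 := Finset.card_le_four
    rw [Finset.card_fin] at h1
    have h3 := Finset.pred_card_le_card_erase (s := Finset.univ \ {u, v, x, y}) (a := w)
    omega
  · exact dependsOnEdges_starPairs fun G H hGH ↦ propext (forall₂_congr hGH)
  · intro z hz
    exact disjoint_starPairs (Finset.ne_of_mem_erase hz).symm (.inl hw)
  · have hcard : ({u, v, x, y} : Finset (Fin n)).card = 4 := by
      rw [Finset.card_insert_of_notMem, Finset.card_insert_of_notMem, Finset.card_pair hxy] <;>
        simp [*]
    have hP := measureReal_forall_adj_le p hw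
    rw [hcard] at hP
    calc _ ≤ Real.exp (-(9 / 20 * Real.log n)) ^ 4 *
          (2 ^ 210 * Real.exp 10 * Real.exp (-(377 / 100) * Real.log n)) := by
          have := h.upper
          refine mul_le_mul_of_nonneg_right (hP.trans ?_) (by positivity)
          gcongr
      _ = 2 ^ 210 * Real.exp 10 *
            Real.exp (4 * -(9 / 20 * Real.log n) + -(377 / 100) * Real.log n) := by
          rw [Real.exp_add, ← Real.exp_nat_mul]
          push_cast
          ring
      _ ≤ _ := by
          gcongr
          linarith

end Window

/-! ### Combining the estimates -/

section Conclusion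

open unitInterval

/-- The deterministic part: a diameter of three is matched by three colours, a diameter of two by
two. -/
lemma rainbowConnectionNumber_eq_ediam_of_scattered {n : ℕ} {G : SimpleGraph (Fin n)} {a b : Fin n}
    (hab : a ≠ b) (hadj : ¬ G.Adj a b)
    (hpath : ∀ u v : Fin n, u ≠ v → ∀ a < 3, ∀ b < 3, a ≠ b →
      ∃ x ∈ residueClass a u v, ∃ y ∈ residueClass b u v, G.Adj u x ∧ G.Adj x y ∧ G.Adj y v)
    (hload : ∀ u w, u ≠ w → edgeLoad 21 (2 / (39 / 20) ^ 2) G u w ≤ 60)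
    (hthin : G.ThinPairsScattered 21) :
    G.rainbowConnectionNumber = G.ediam ∧ G.ediam ∈ ({2, 3} : Set ℕ∞) := by
  have h1 := G.ediam_le_rainbowConnectionNumber
  have h3 := rainbowConnectionNumber_le_three hpath
  have h2 : 2 ≤ G.ediam := by
    have : 1 < G.edist a b := by
      rw [← not_le, edist_le_one_iff_adj_or_eq]
      tauto
    have := Order.add_one_le_of_lt (this.trans_le edist_le_ediam)
    rwa [one_add_one_eq_two] at this
  by_cases hd : G.ediam ≤ 2
  · have hrc : G.rainbowConnectionNumber ≤ 2 := by
      refine rainbowConnectionNumber_le_two (fun u v huv huv' ↦ ?_) hthin (β := 39 / 20) (T := 60)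
        (by norm_num) (by norm_num) (by norm_num) (by norm_num) hload (by norm_num)
      have := (edist_le_ediam (u := u) (v := v)).trans hd
      rw [← not_lt, two_lt_edist_iff] at this
      by_contra! hno
      refine this ⟨huv, huv', Set.eq_empty_of_forall_notMem fun w hw ↦ ?_⟩
      rw [mem_commonNeighbors] at hw
      exact hno w hw.1 hw.2
    have he : G.ediam = 2 := le_antisymm hd h2
    exact ⟨le_antisymm (hrc.trans h2) h1, by simp [he]⟩
  · have h3' : 3 ≤ G.ediam := by
      have := Order.add_one_le_of_lt (not_le.1 hd)
      rwa [two_add_one_eq_three] at this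
    have he : G.ediam = 3 := le_antisymm (h1.trans h3) h3'
    exact ⟨le_antisymm (h3.trans h3') h1, by simp [he]⟩

lemma measureReal_and_le {V : Type*} [Fintype V] (p : I) {P : Prop}
    {E : SimpleGraph V → Prop} {B : ℝ} (hB : 0 ≤ B)
    (h : P → (binomialRandom V p).real {G | E G} ≤ B) :
    (binomialRandom V p).real {G | P ∧ E G} ≤ B := by
  by_cases hP : P <;> simp_all

/-- In the density window the exceptional probability decays like a power of `n`. -/
lemma exists_measureReal_compl_le : ∃ C : ℝ, ∀ (n : ℕ) (p : I), DensityWindow n p →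
    (binomialRandom (Fin n) p).real
      {G | G.rainbowConnectionNumber = G.ediam ∧ G.ediam ∈ ({2, 3} : Set ℕ∞)}ᶜ ≤
      C * Real.exp (-(1 / 5) * Real.log n) := by
  refine ⟨1 + 18 + (1 + Real.exp (2 ^ 23)) + 2 ^ 210 * Real.exp 7 + 2 ^ 210 * Real.exp 10 +
    2 ^ 210 * Real.exp 10, fun n p h ↦ ?_⟩
  set μ := binomialRandom (Fin n) p
  have hn : 1000 ≤ n := by exact_mod_cast h.cast_ge
  have hL := h.log_ge
  let a : Fin n := ⟨0, by omega⟩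
  let b : Fin n := ⟨1, by omega⟩
  have hab : a ≠ b := by simp [a, b]
  set e := Real.exp (-(1 / 5) * Real.log n)
  have e1 : μ.real {G | G.Adj a b} ≤ 1 * e := by
    rw [measureReal_adj p hab, one_mul]
    exact h.upper.trans (Real.exp_le_exp.2 (by linarith))
  have e2 : μ.real {G | ∃ u v : Fin n, ∃ c d : Fin 3, u ≠ v ∧ c ≠ d ∧
      ¬ ∃ x ∈ residueClass c u v, ∃ y ∈ residueClass d u v,
        G.Adj u x ∧ G.Adj x y ∧ G.Adj y v} ≤ 18 * e := by
    refine le_trans (measureReal_exists_le p fun u ↦ measureReal_exists_le p fun v ↦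
      measureReal_exists_le p fun c ↦ measureReal_exists_le p fun d ↦
      measureReal_and_le p (by positivity) fun huv ↦
        measureReal_and_le p (by positivity) fun hcd ↦
        measureReal_no_residue_path_le h huv c.2 d.2 (Fin.val_ne_of_ne hcd)) ?_
    have := h.pow_mul_exp_le (k := 2) (c := -3) (d := -(1 / 5)) (by norm_num)
    simp only [Fintype.card_fin]
    push_cast
    linarith
  have e3 : μ.real {G | ∃ u w : Fin n, u ≠ w ∧
      60 < edgeLoad 21 (2 / (39 / 20) ^ 2) G u w} ≤ (1 + Real.exp (2 ^ 23)) * e := by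
    refine le_trans (measureReal_exists_le p fun u ↦ measureReal_exists_le p fun w ↦
      measureReal_and_le p (by positivity) fun huw ↦ measureReal_edgeLoad_gt_le h huw) ?_
    have := h.pow_mul_exp_le (k := 2) (c := -3) (d := -(1 / 5)) (by norm_num)
    rw [Fintype.card_fin]
    calc _ = (1 + Real.exp (2 ^ 23)) * ((n : ℝ) ^ 2 * Real.exp (-3 * Real.log n)) := by ring
      _ ≤ _ := by gcongr
  have e4 : μ.real {G | ∃ u v w : Fin n, v ≠ w ∧ G.IsThin 21 u v ∧ G.IsThin 21 u w} ≤
      2 ^ 210 * Real.exp 7 * e := by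
    refine le_trans (measureReal_exists_le p fun u ↦ measureReal_exists_le p fun v ↦
      measureReal_exists_le p fun w ↦ measureReal_thin_meet_le h u v w) ?_
    have := h.pow_mul_exp_le (k := 3) (c := -(37 / 10)) (d := -(1 / 5)) (by norm_num)
    rw [Fintype.card_fin]
    calc _ = 2 ^ 210 * Real.exp 7 * ((n : ℝ) ^ 3 * Real.exp (-(37 / 10) * Real.log n)) := by ring
      _ ≤ _ := by gcongr
  have e5 : μ.real {G | ∃ u v x y : Fin n, G.IsThin 21 u v ∧ G.IsThin 21 x y ∧
      (u ≠ x ∧ u ≠ y ∧ v ≠ x ∧ v ≠ y) ∧ G.Adj u x} ≤ 2 ^ 210 * Real.exp 10 * e := by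
    refine le_trans (measureReal_exists_le p fun u ↦ measureReal_exists_le p fun v ↦
      measureReal_exists_le p fun x ↦ measureReal_exists_le p fun y ↦
      measureReal_thin_adj_le h u v x y) ?_
    have := h.pow_mul_exp_le (k := 4) (c := -(421 / 100)) (d := -(1 / 5)) (by norm_num)
    rw [Fintype.card_fin]
    calc _ = 2 ^ 210 * Real.exp 10 * ((n : ℝ) ^ 4 * Real.exp (-(421 / 100) * Real.log n)) := by
          ring
      _ ≤ _ := by gcongr
  have e6 : μ.real {G | ∃ w u v x y : Fin n, G.IsThin 21 u v ∧ G.IsThin 21 x y ∧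
      (u ≠ x ∧ u ≠ y ∧ v ≠ x ∧ v ≠ y) ∧ (G.Adj w u ∧ G.Adj w v ∧ G.Adj w x ∧ G.Adj w y)} ≤
      2 ^ 210 * Real.exp 10 * e := by
    refine le_trans (measureReal_exists_le p fun w ↦ measureReal_exists_le p fun u ↦
      measureReal_exists_le p fun v ↦ measureReal_exists_le p fun x ↦
      measureReal_exists_le p fun y ↦ measureReal_thin_common_le h w u v x y) ?_
    have := h.pow_mul_exp_le (k := 5) (c := -(555 / 100)) (d := -(1 / 5)) (by norm_num)
    rw [Fintype.card_fin]
    calc _ = 2 ^ 210 * Real.exp 10 * ((n : ℝ) ^ 5 * Real.exp (-(555 / 100) * Real.log n)) := by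
          ring
      _ ≤ _ := by gcongr
  rw [add_mul, add_mul, add_mul, add_mul, add_mul]
  refine (measureReal_mono ?_).trans <|
    (measureReal_union_le _ _).trans <| add_le_add
    ((measureReal_union_le _ _).trans <| add_le_add
    ((measureReal_union_le _ _).trans <| add_le_add
    ((measureReal_union_le _ _).trans <| add_le_add
    ((measureReal_union_le _ _).trans <| add_le_add e1 e2) e3) e4) e5) e6
  intro G hG
  by_contra hcon
  simp only [Set.mem_union, Set.mem_ofPred_eq, not_or] at hcon
  obtain ⟨⟨⟨⟨⟨g1, g2⟩, g3⟩, g4⟩, g5⟩, g6⟩ := hcon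
  refine hG (rainbowConnectionNumber_eq_ediam_of_scattered hab g1
    (fun u v huv c hc d hd hcd ↦ ?_) (fun u w huw ↦ ?_) ⟨fun u v w huv huw ↦ ?_,
      fun u v x y huv hxy h1 h2 h3 h4 ↦ ?_, fun w u v x y huv hxy h1 h2 h3 h4 h5 ↦ ?_⟩)
  · by_contra hno
    exact g2 ⟨u, v, ⟨c, hc⟩, ⟨d, hd⟩, huv, by simpa using hcd, hno⟩
  · by_contra hw
    exact g3 ⟨u, w, huw, not_le.1 hw⟩
  · by_contra hvw
    exact g4 ⟨u, v, w, hvw, huv, huw⟩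
  · exact fun h5 ↦ g5 ⟨u, v, x, y, huv, hxy, ⟨h1, h2, h3, h4⟩, h5⟩
  · exact g6 ⟨w, u, v, x, y, huv, hxy, ⟨h1, h2, h3, h4⟩, h5⟩

lemma eventually_densityWindow {ω : ℕ → ℝ} (hω : ω =o[atTop] (fun n : ℕ => Real.log (n : ℝ)))
    {p : ℕ → I} (hp : ∀ᶠ n : ℕ in atTop,
      (p n : ℝ) = Real.sqrt ((2 * Real.log (n : ℝ) + ω n) / (n : ℝ))) :
    ∀ᶠ n : ℕ in atTop, DensityWindow n (p n) := by
  have hlog : Tendsto (fun n : ℕ ↦ Real.log n) atTop atTop :=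
    Real.tendsto_log_atTop.comp tendsto_natCast_atTop_atTop
  filter_upwards [hp, hω.bound (show (0 : ℝ) < 1 / 20 by norm_num),
    hlog.eventually_ge_atTop 600, eventually_gt_atTop 0] with n hp hω hL hn
  have hn' : (0 : ℝ) < n := by exact_mod_cast hn
  set L := Real.log n with hLdef
  rw [Real.norm_eq_abs, Real.norm_of_nonneg (by linarith), abs_le] at hω
  have hsq : (p n : ℝ) ^ 2 = (2 * L + ω n) / n := by
    rw [hp, Real.sq_sqrt]
    exact div_nonneg (by linarith) hn'.le
  refine ⟨by linarith, ?_, ?_⟩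
  · rw [hsq, mul_div_cancel₀ _ hn'.ne']
    linarith
  · change (p n : ℝ) ≤ Real.exp (-(9 / 20 * L))
    refine abs_le_of_sq_le_sq' ?_ (Real.exp_nonneg _) |>.2
    have hexp : 3 * L ≤ Real.exp (L / 10) := by
      have := Real.quadratic_le_exp_of_nonneg (show 0 ≤ L / 10 by linarith)
      nlinarith
    have hnexp : (n : ℝ) = Real.exp L := (Real.exp_log hn').symm
    rw [hsq, div_le_iff₀ hn', hnexp, ← Real.exp_nat_mul, ← Real.exp_add]
    refine (show 2 * L + ω n ≤ 3 * L by linarith).trans (hexp.trans (Real.exp_le_exp.2 ?_))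
    push_cast
    linarith

end Conclusion

end SimpleGraph

theorem theorem1 (ω : ℕ → ℝ)
    (hω : ω =o[atTop] (fun n : ℕ => Real.log (n : ℝ)))
    (p : ℕ → unitInterval)
    (hp : ∀ᶠ n : ℕ in atTop,
      (p n : ℝ) = Real.sqrt ((2 * Real.log (n : ℝ) + ω n) / (n : ℝ))) :
    Tendsto
      (fun n : ℕ => SimpleGraph.binomialRandom (Fin n) (p n)
        {G : SimpleGraph (Fin n) |
          G.rainbowConnectionNumber = G.ediam ∧ G.ediam ∈ ({2, 3} : Set ℕ∞)})
      atTop (𝓝 1) := by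
  obtain ⟨C, hC⟩ := SimpleGraph.exists_measureReal_compl_le
  have hlog : Tendsto (fun n : ℕ ↦ Real.log n) atTop atTop :=
    Real.tendsto_log_atTop.comp tendsto_natCast_atTop_atTop
  have hlim : Tendsto (fun n : ℕ ↦ 1 - C * Real.exp (-(1 / 5) * Real.log n)) atTop (𝓝 1) := by
    have h1 : Tendsto (fun n : ℕ ↦ Real.exp (-(1 / 5) * Real.log n)) atTop (𝓝 0) :=
      Real.tendsto_exp_atBot.comp (hlog.const_mul_atTop_of_neg (by norm_num))
    simpa using (h1.const_mul C).const_sub 1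
  rw [← ENNReal.tendsto_toReal_iff (fun _ ↦ measure_ne_top _ _) ENNReal.one_ne_top,
    ENNReal.toReal_one]
  refine tendsto_of_tendsto_of_tendsto_of_le_of_le' hlim tendsto_const_nhds ?_
    (.of_forall fun n ↦ measureReal_le_one)
  filter_upwards [SimpleGraph.eventually_densityWindow hω hp] with n hn
  have h1 := hC n (p n) hn
  rw [probReal_compl_eq_one_sub .of_discrete, measureReal_def] at h1
  linarith
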